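/- Let $m\ge 2$ and $d\ge 1$ be integers and let $s>\frac{(m-1)d}{2}+\frac12$. Let $\sigma$ be a finite positive Borel measure on $\mathbb{R}^{md}=(\mathbb{R}^d)^m$, supported in the closed unit ball, whose Fourier transform $\widehat{\sigma}(\xi)=\int e^{-2\pi i y\cdot\xi}\,d\sigma(y)$ satisfies, for some constant $A$, $$|\widehat{\sigma}(\xi)|\le A\,(1+|\xi|)^{-s}\qquad\text{for all }\xi\in\mathbb{R}^{md}.$$ For Schwartz functions $f_1,\dots,f_m\colon\mathbb{R}^d\to\mathbb{C}$, write $F=(f_1,\dots,f_m)$ and $$\mathrm{M}^{loc}_\sigma(F)(x)=\sup_{1<t<2}\Big|\int_{\mathbb{R}^{md}}\prod_{i=1}^m f_i(x-ty_i)\,d\sigma(y)\Big|,\qquad x\in\mathbb{R}^d,\quad y=(y_1,\dots,y_m).$$ Then there is a finite constant $C$, independent of $f_1,\dots,f_m$ and of $p$, such that for all Schwartz functions $f_1,\dots,f_m$ and all $p$ with $\frac2m\le p\le 2$, $$\|\mathrm{M}^{loc}_\sigma(F)\|_{L^p(\mathbb{B}^d(0,1))}\le C\prod_{i=1}^m\|f_i\|_{L^2(\mathbb{R}^d)},$$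 where $\mathbb{B}^d(0,1)$ is the unit ball of $\mathbb{R}^d$ centered at the origin, and moreover $$\|\mathrm{M}^{loc}_\sigma(F)\|_{L^{2/m}(\mathbb{R}^d)}\le C\prod_{i=1}^m\|f_i\|_{L^2(\mathbb{R}^d)}.$$ Here $\|g\|_{L^p(E)}=\left(\int_E|g|^p\right)^{1/p}$ also for $0<p<1$. -/

import Mathlib

open MeasureTheory
open scoped SchwartzMap ENNReal NNReal

/-- The space `ℝ^d` with its Euclidean norm. -/
abbrev Rd (d : ℕ) : Type := EuclideanSpace ℝ (Fin d)

/-- The space `ℝ^{md} = (ℝ^d)^m` with its Euclidean norm; a point is `y = (y 0, …, y (m - 1))`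
with blocks `y i` in `ℝ^d`. -/
abbrev Rmd (m d : ℕ) : Type := PiLp 2 (fun _ : Fin m => Rd d)

/-- The Fourier transform `σ̂(ξ) = ∫ e^{-2πi y·ξ} dσ(y)` of a measure on `ℝ^{md}`. -/
noncomputable def measureFourier {m d : ℕ} (σ : Measure (Rmd m d)) (ξ : Rmd m d) : ℂ :=
  ∫ y, Complex.exp (-(2 * Real.pi * (inner ℝ y ξ : ℝ) : ℝ) * Complex.I) ∂σ

/-- The multilinear average `A_σ(F)(x, t) = ∫ ∏ i, f_i (x - t y_i) dσ(y)`. -/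
noncomputable def multiAverage {m d : ℕ} (σ : Measure (Rmd m d)) (f : Fin m → 𝓢(Rd d, ℂ))
    (x : Rd d) (t : ℝ) : ℂ :=
  ∫ y, ∏ i, f i (x - t • y i) ∂σ

/-- The multilinear local maximal function `sup_{1 < t < 2} |A_σ(F)(x, t)|`, with values
in `[0, ∞]`. -/
noncomputable def localMaximal {m d : ℕ} (σ : Measure (Rmd m d)) (f : Fin m → 𝓢(Rd d, ℂ))
    (x : Rd d) : ℝ≥0∞ :=
  ⨆ t ∈ Set.Ioo (1 : ℝ) 2, ‖multiAverage σ f x t‖ₑ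

/-! Fourier inversion in each factor writes the average at `(x, t)` as the restriction to the
diagonal `(x, …, x)` of the inverse Fourier transform of `(⊗ f̂_i)(ξ) σ̂(tξ)` on `ℝ^{md}`. The heart
of the proof is an `L² × ⋯ × L² → L²(ℝ^d)` bound, proved on dyadic shells `1 + |ξ| ~ 2^j`; the other
exponents follow by localization.

Three costs compete on a shell. Restriction to the diagonal loses `2^{j(m-1)d/2}` in `L²`
(`lintegral_enorm_sq_diagonalFourierInv_le`): a frequency `η` on the diagonal collects all `ξ` with
`∑ ξ_i = η`, a set with `m - 1` free variables in balls of radius about `2^j`. The supremum over `t`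
loses `2^{j/2}` by a one-dimensional Sobolev inequality (`iSup_enorm_sq_le`), since a `t`-derivative
of `σ̂(tξ)` costs a factor `|ξ|`. The decay of `σ̂` gains `2^{-js}`. The hypothesis on `s` says
exactly that the product decays geometrically in `j`, so the shells can be summed
(`lintegral_localMaximal_shell_le`, `lintegral_tsum_sq_le`). The derivative decays like `|ξ|(1 +
|tξ|)^{-s}` because, on the support of `σ`, the coordinates of `y` agree with Schwartz functions,
and multiplication by these preserves Fourier decay.

On a unit ball, Hölder lowers the exponent from `2` to any `p ≥ 2/m`. Since `t < 2` and `|y| ≤ 1`,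
only the values of the `f_i` within distance `3` of the centre matter there. At `p = 2/m` the local
bounds, raised to the power `p`, can be integrated over all centres: Hölder with `m` exponents `1/m`
recombines the local `L²` norms into global ones. -/

open scoped FourierTransform ContDiff ComplexConjugate

/-! ### Restriction to the diagonal: the `L²` trace inequality. -/

section Extension

variable {E : Type*} [NormedAddCommGroup E] [InnerProductSpace ℝ E] [FiniteDimensional ℝ E]
  [MeasurableSpace E] [BorelSpace E]

/-- The bilinear pairing `(ξ, x) ↦ ⟪∑ i, ξ i, x⟫` of `E^m` with `E`. -/
noncomputable def sumInner (E : Type*) [NormedAddCommGroup E] [InnerProductSpace ℝ E] (m : ℕ) :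
    (Fin m → E) →L[ℝ] E →L[ℝ] ℝ :=
  (innerSL ℝ).comp (∑ i : Fin m, ContinuousLinearMap.proj i)

@[simp] lemma sumInner_apply {E : Type*} [NormedAddCommGroup E] [InnerProductSpace ℝ E] {m : ℕ}
    (ξ : Fin m → E) (x : E) : sumInner E m ξ x = inner ℝ (∑ i, ξ i) x := by
  simp [sumInner, sum_inner]

/-- The restriction to the diagonal of the inverse Fourier transform of a function on `E^m`. -/
noncomputable def diagonalFourierInv {m : ℕ} (H : (Fin m → E) → ℂ) (x : E) : ℂ :=
  ∫ ξ : Fin m → E, (Real.fourierChar (inner ℝ (∑ i, ξ i) x) : ℂ) * H ξ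

/-- Gives access to smoothness and to the duality formula for Fourier integrals along a general
bilinear form; the sign turns the forward transform into the inverse one. -/
lemma diagonalFourierInv_eq_fourierIntegral {m : ℕ} (H : (Fin m → E) → ℂ) :
    diagonalFourierInv H =
      VectorFourier.fourierIntegral 𝐞 volume (-sumInner E m).toLinearMap₁₂ H := by
  ext x
  simp [diagonalFourierInv, VectorFourier.fourierIntegral, Circle.smul_def]

/-- Integrating a function of `∑ i, ξ i` over a product of `n + 1` balls. -/
lemma lintegral_indicator_comp_sum_le (n : ℕ) (R : ℝ) {G : E → ℝ≥0∞} (hG : Measurable G) :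
    ∫⁻ ξ : Fin (n + 1) → E, (Set.univ.pi fun _ => Metric.closedBall (0 : E) R).indicator
        (fun ξ => G (∑ i, ξ i)) ξ ≤
      volume (Metric.closedBall (0 : E) R) ^ n * ∫⁻ η, G η := by
  have hmeas : ∀ k : ℕ, MeasurableSet (Set.univ.pi fun _ : Fin k => Metric.closedBall (0 : E) R) :=
    fun k => MeasurableSet.univ_pi fun _ => Metric.isClosed_closedBall.measurableSet
  have hF : Measurable fun ξ : Fin (n + 1) → E =>
      (Set.univ.pi fun _ => Metric.closedBall (0 : E) R).indicator
        (fun ξ => G (∑ i, ξ i)) ξ := by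
    refine Measurable.indicator (hG.comp ?_) (hmeas _)
    fun_prop
  have hp := (volume_preserving_piFinSuccAbove (fun _ : Fin (n + 1) => E) 0).symm
  -- Split off `ξ 0`: its integral is enlarged to all of `E` and absorbs the sum by translation
  -- invariance. The other `n` variables contribute the volumes of their balls.
  rw [← hp.lintegral_comp hF, Measure.volume_eq_prod]
  refine (lintegral_prod_symm _ (hF.comp hp.measurable).aemeasurable).le.trans ?_
  calc _ ≤ ∫⁻ ξ' : Fin n → E, (Set.univ.pi fun _ => Metric.closedBall (0 : E) R).indicator
        (fun _ => ∫⁻ η, G η) ξ' := by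
        refine lintegral_mono fun ξ' => ?_
        by_cases h : ξ' ∈ Set.univ.pi fun _ : Fin n => Metric.closedBall (0 : E) R
        · rw [Set.indicator_of_mem h]
          calc _ ≤ ∫⁻ η, G (η + ∑ i, ξ' i) := by
                refine lintegral_mono fun η => ?_
                simp only [Function.comp_apply]
                refine (Set.indicator_le_self (M := ℝ≥0∞) _ _ _).trans ?_
                simp [MeasurableEquiv.piFinSuccAbove, Fin.sum_univ_succ]
            _ = _ := lintegral_add_right_eq_self G _
        · rw [Set.indicator_of_notMem h]
          refine le_of_eq ?_
          rw [lintegral_eq_zero_iff' ?_]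
          · refine Filter.Eventually.of_forall fun η => ?_
            simp only [Function.comp_apply, Pi.zero_apply]
            refine Set.indicator_of_notMem (fun h' => h fun i _ => ?_) _
            have := h' i.succ trivial
            simpa [MeasurableEquiv.piFinSuccAbove] using this
          · exact ((hF.comp hp.measurable).comp measurable_prodMk_right).aemeasurable
    _ = _ := by
        rw [lintegral_indicator (hmeas n), setLIntegral_const, volume_pi_pi]
        simp [mul_comm]

lemma lintegral_enorm_sq_schwartz (h : 𝓢(E, ℂ)) :
    ∫⁻ x, ‖h x‖ₑ ^ 2 = ENNReal.ofReal (∫ x, ‖h x‖ ^ 2) := by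
  rw [ofReal_integral_eq_lintegral_ofReal]
  · refine lintegral_congr fun x => ?_
    rw [ENNReal.ofReal_pow (norm_nonneg _), ofReal_norm]
  · exact (h.memLp 2).integrable_norm_pow (by norm_num)
  · exact Filter.Eventually.of_forall fun x => by positivity

lemma lintegral_enorm_sq_fourierInv (g : 𝓢(E, ℂ)) :
    ∫⁻ x, ‖𝓕⁻ g x‖ₑ ^ 2 = ∫⁻ x, ‖g x‖ₑ ^ 2 := by
  have := SchwartzMap.integral_norm_sq_fourier (𝓕⁻ g)
  rw [lintegral_enorm_sq_schwartz, lintegral_enorm_sq_schwartz, ← this]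
  simp

/-- Bounded frequency support makes every moment of `H` integrable, so one may differentiate under
the integral to any order. -/
lemma diagonalFourierInv_contDiff {m : ℕ} {H : (Fin m → E) → ℂ} {R : ℝ}
    (hH : Integrable H) (hsupp : ∀ ξ, H ξ ≠ 0 → ∀ i, ‖ξ i‖ ≤ R) :
    ContDiff ℝ ∞ (diagonalFourierInv H) := by
  rw [diagonalFourierInv_eq_fourierIntegral]
  refine VectorFourier.contDiff_fourierIntegral _ fun k _ => ?_
  refine (hH.norm.const_mul (|R| ^ k)).mono' ?_ (Filter.Eventually.of_forall fun ξ => ?_)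
  · exact (by fun_prop : Continuous fun ξ : Fin m → E => ‖ξ‖ ^ k).aestronglyMeasurable.mul
      hH.norm.aestronglyMeasurable
  · by_cases h : H ξ = 0
    · simp [h]
    · rw [norm_mul, norm_norm, norm_pow, norm_norm]
      gcongr
      exact (pi_norm_le_iff_of_nonneg (abs_nonneg R)).2
        fun i => (hsupp ξ h i).trans (le_abs_self R)

/-- An `L²` trace inequality: the restriction to the diagonal of a function with frequencies in
a product of balls. -/
lemma lintegral_enorm_sq_diagonalFourierInv_le (n : ℕ) {R : ℝ} {H : (Fin (n + 1) → E) → ℂ}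
    (hH : Integrable H) (hsupp : ∀ ξ, H ξ ≠ 0 → ∀ i, ‖ξ i‖ ≤ R) :
    ∫⁻ x, ‖diagonalFourierInv H x‖ₑ ^ 2 ≤
      volume (Metric.closedBall (0 : E) R) ^ n * ∫⁻ ξ, ‖H ξ‖ₑ ^ 2 := by
  set u := diagonalFourierInv H with hu
  have hus : ContDiff ℝ ∞ u := diagonalFourierInv_contDiff hH hsupp
  set K := volume (Metric.closedBall (0 : E) R) ^ n * ∫⁻ ξ, ‖H ξ‖ₑ ^ 2 with hK
  -- Duality: with `X = ∫ χ|u|²`, test `u` against `g = ū χ` and move the transform onto `g`.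
  -- Cauchy–Schwarz and Plancherel give `X² ≤ K ‖g‖₂² ≤ K X`, and `X` is finite because of the
  -- cutoff.
  have main : ∀ N : ℕ, ∫⁻ x in Metric.ball (0 : E) N, ‖u x‖ₑ ^ 2 ≤ K := by
    intro N
    -- The inner radius is `N + 1` because it must be positive also for `N = 0`.
    let χ : ContDiffBump (0 : E) := ⟨N + 1, N + 2, by positivity, by linarith⟩
    have hχs : ContDiff ℝ ∞ fun x => (χ x : ℂ) := Complex.ofRealCLM.contDiff.comp χ.contDiff
    have hχc : HasCompactSupport fun x => (χ x : ℂ) := 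
      HasCompactSupport.comp_left (g := Complex.ofReal) χ.hasCompactSupport Complex.ofReal_zero
    have hgs : ContDiff ℝ ∞ fun x => conj (u x) * (χ x : ℂ) :=
      (Complex.conjCLE.contDiff.comp hus).mul hχs
    let g : 𝓢(E, ℂ) := hχc.mul_left.toSchwartzMap hgs
    have hg : ∀ x, g x = conj (u x) * (χ x : ℂ) := fun x => rfl
    set X := ∫⁻ x, ENNReal.ofReal (χ x) * ‖u x‖ₑ ^ 2 with hX
    have hXr : Integrable fun x => χ x * ‖u x‖ ^ 2 := by
      refine Continuous.integrable_of_hasCompactSupport ?_ χ.hasCompactSupport.mul_right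
      exact χ.continuous.mul (hus.continuous.norm.pow 2)
    have hX' : X = ENNReal.ofReal (∫ x, χ x * ‖u x‖ ^ 2) := by
      rw [ofReal_integral_eq_lintegral_ofReal hXr
        (Filter.Eventually.of_forall fun x => mul_nonneg χ.nonneg (by positivity))]
      refine lintegral_congr fun x => ?_
      rw [ENNReal.ofReal_mul χ.nonneg, ENNReal.ofReal_pow (norm_nonneg _), ofReal_norm]
    have hdual : ∫ x, u x • g x = ∫ ξ, H ξ • 𝓕⁻ g (∑ i, ξ i) := by
      rw [hu, diagonalFourierInv_eq_fourierIntegral,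
        VectorFourier.integral_fourierIntegral_smul_eq_flip Real.continuous_fourierChar _ hH
          g.integrable]
      · congr 1
        ext ξ
        congr 1
        rw [SchwartzMap.fourierInv_coe, Real.fourierInv_eq]
        simp only [VectorFourier.fourierIntegral]
        refine integral_congr_ae (Filter.Eventually.of_forall fun x => ?_)
        simp [LinearMap.flip_apply, real_inner_comm]
      · exact ((-sumInner E (n + 1)).isBoundedBilinearMap).continuous
    have hug : ∫ x, u x • g x = ((∫ x, χ x * ‖u x‖ ^ 2 : ℝ) : ℂ) := by
      rw [← integral_complex_ofReal]
      refine integral_congr_ae (Filter.Eventually.of_forall fun x => ?_)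
      simp only [hg, smul_eq_mul, ← mul_assoc, Complex.mul_conj']
      push_cast
      ring
    have hXnorm : X = ‖∫ ξ, H ξ • 𝓕⁻ g (∑ i, ξ i)‖ₑ := by
      rw [← hdual, hug, hX', ← ofReal_norm, Complex.norm_real, Real.norm_of_nonneg]
      exact integral_nonneg fun x => mul_nonneg χ.nonneg (by positivity)
    set B := Set.univ.pi fun _ : Fin (n + 1) => Metric.closedBall (0 : E) R with hB
    have hgX : ∫⁻ x, ‖g x‖ₑ ^ 2 ≤ X := by
      refine lintegral_mono fun x => ?_
      rw [hg, enorm_mul, mul_pow, mul_comm]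
      have h1 : ‖conj (u x)‖ₑ = ‖u x‖ₑ := by rw [← ofReal_norm, ← ofReal_norm, RCLike.norm_conj]
      have h2 : ‖(χ x : ℂ)‖ₑ = ENNReal.ofReal (χ x) := by
        rw [← ofReal_norm, Complex.norm_real, Real.norm_of_nonneg χ.nonneg]
      rw [h1, h2]
      gcongr
      rw [sq]
      calc _ ≤ ENNReal.ofReal (χ x) * 1 := by
            gcongr
            exact ENNReal.ofReal_le_one.2 χ.le_one
        _ = _ := mul_one _
    have hcs : X ^ 2 ≤ K * X := by
      have hstep : X ≤ ∫⁻ ξ, ‖H ξ‖ₑ * B.indicator (fun ξ => ‖𝓕⁻ g (∑ i, ξ i)‖ₑ) ξ := by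
        rw [hXnorm]
        refine (enorm_integral_le_lintegral_enorm _).trans (lintegral_mono fun ξ => ?_)
        by_cases h : H ξ = 0
        · simp [h]
        · rw [Set.indicator_of_mem, smul_eq_mul, enorm_mul]
          exact fun i _ => by simpa using hsupp ξ h i
      have hmB : MeasurableSet B :=
        MeasurableSet.univ_pi fun _ => Metric.isClosed_closedBall.measurableSet
      have hGm : Measurable fun ξ : Fin (n + 1) → E => ‖𝓕⁻ g (∑ i, ξ i)‖ₑ := by
        have : Continuous fun ξ : Fin (n + 1) → E => 𝓕⁻ g (∑ i, ξ i) :=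
          (𝓕⁻ g).continuous.comp (by fun_prop)
        exact this.enorm.measurable
      have hold := ENNReal.lintegral_mul_le_Lp_mul_Lq volume Real.HolderConjugate.two_two
        hH.aestronglyMeasurable.enorm (hGm.indicator hmB).aemeasurable
      have hsq : ∫⁻ ξ, B.indicator (fun ξ => ‖𝓕⁻ g (∑ i, ξ i)‖ₑ) ξ ^ 2 ≤
          volume (Metric.closedBall (0 : E) R) ^ n * X := by
        have := lintegral_indicator_comp_sum_le n R
          (G := fun η => ‖𝓕⁻ g η‖ₑ ^ 2) ((𝓕⁻ g).continuous.enorm.measurable.pow_const 2)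
        refine (le_of_eq ?_).trans (this.trans ?_)
        · refine lintegral_congr fun ξ => ?_
          by_cases h : ξ ∈ B <;> simp [h, ← hB]
        · rw [lintegral_enorm_sq_fourierInv]
          gcongr
      have h3 := hstep.trans hold
      simp only [ENNReal.rpow_two] at h3
      calc X ^ 2 ≤ ((∫⁻ ξ, ‖H ξ‖ₑ ^ 2) ^ (1 / 2 : ℝ) *
            (∫⁻ ξ, B.indicator (fun ξ => ‖𝓕⁻ g (∑ i, ξ i)‖ₑ) ξ ^ 2) ^ (1 / 2 : ℝ)) ^ 2 := by
              gcongr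
        _ = (∫⁻ ξ, ‖H ξ‖ₑ ^ 2) *
            ∫⁻ ξ, B.indicator (fun ξ => ‖𝓕⁻ g (∑ i, ξ i)‖ₑ) ξ ^ 2 := by
              rw [mul_pow, ← ENNReal.rpow_natCast, ← ENNReal.rpow_natCast, ← ENNReal.rpow_mul,
                ← ENNReal.rpow_mul]
              norm_num
        _ ≤ (∫⁻ ξ, ‖H ξ‖ₑ ^ 2) * (volume (Metric.closedBall (0 : E) R) ^ n * X) := by gcongr
        _ = K * X := by rw [hK]; ring
    have hXK : X ≤ K := by
      by_cases h0 : X = 0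
      · simp [h0]
      · rw [sq] at hcs
        exact (ENNReal.mul_le_mul_iff_left h0 (by rw [hX']; exact ENNReal.ofReal_ne_top)).1 hcs
    refine le_trans ?_ hXK
    rw [← lintegral_indicator Metric.isOpen_ball.measurableSet]
    refine lintegral_mono fun x => ?_
    by_cases h : x ∈ Metric.ball (0 : E) N
    · rw [Set.indicator_of_mem h, χ.one_of_mem_closedBall, ENNReal.ofReal_one, one_mul]
      have : ‖x‖ < N := by simpa using h
      simp only [mem_closedBall_zero_iff]
      change ‖x‖ ≤ (N : ℝ) + 1
      linarith
    · simp [h]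
  have hcov := (aecover_ball (μ := (volume : Measure E)) (x := 0)
    tendsto_natCast_atTop_atTop).lintegral_tendsto_of_countably_generated
    (f := fun x => ‖u x‖ₑ ^ 2) (hus.continuous.enorm.measurable.pow_const 2).aemeasurable
  exact le_of_tendsto' hcov main

end Extension

/-! ### A Sobolev inequality in the dilation parameter. -/

section Sobolev

/-- Integrate `(|g|²)' = 2⟪g, g'⟫` from `1` to `t` and use `2ab ≤ c a² + c⁻¹ b²`. The free weight
`c` is later matched to the frequency. -/
lemma norm_sq_le_add_integral {g g' : ℝ → ℂ} (hg : ∀ t, HasDerivAt g (g' t) t)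
    (hg' : Continuous g') {c : ℝ} (hc : 0 < c) {t : ℝ} (ht : t ∈ Set.Icc (1 : ℝ) 2) :
    ‖g t‖ ^ 2 ≤ ‖g 1‖ ^ 2 + ∫ τ in (1 : ℝ)..2, (c * ‖g τ‖ ^ 2 + c⁻¹ * ‖g' τ‖ ^ 2) := by
  have hgc : Continuous g := continuous_iff_continuousAt.2 fun t => (hg t).continuousAt
  have hd : ∀ τ, HasDerivAt (fun τ => ‖g τ‖ ^ 2) (2 * inner ℝ (g τ) (g' τ)) τ :=
    fun τ => (hg τ).norm_sq
  have hcont : Continuous fun τ => 2 * inner ℝ (g τ) (g' τ) :=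
    continuous_const.mul (hgc.inner hg')
  have hcont2 : Continuous fun τ => c * ‖g τ‖ ^ 2 + c⁻¹ * ‖g' τ‖ ^ 2 := by fun_prop
  have hftc := intervalIntegral.integral_eq_sub_of_hasDerivAt (fun τ _ => hd τ)
    (hcont.intervalIntegrable 1 t)
  have h1 : ∫ τ in (1 : ℝ)..t, 2 * inner ℝ (g τ) (g' τ) ≤
      ∫ τ in (1 : ℝ)..t, (c * ‖g τ‖ ^ 2 + c⁻¹ * ‖g' τ‖ ^ 2) := by
    refine intervalIntegral.integral_mono_on ht.1 (hcont.intervalIntegrable _ _)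
      (hcont2.intervalIntegrable _ _) fun τ _ => ?_
    have h2 : inner ℝ (g τ) (g' τ) ≤ ‖g τ‖ * ‖g' τ‖ := real_inner_le_norm _ _
    have h3 : c * ‖g τ‖ ^ 2 + c⁻¹ * ‖g' τ‖ ^ 2 - 2 * (‖g τ‖ * ‖g' τ‖) =
        c⁻¹ * (c * ‖g τ‖ - ‖g' τ‖) ^ 2 := by
      field_simp
      ring
    have h4 : 0 ≤ c⁻¹ * (c * ‖g τ‖ - ‖g' τ‖) ^ 2 := by positivity
    linarith
  have h2 : ∫ τ in (1 : ℝ)..t, (c * ‖g τ‖ ^ 2 + c⁻¹ * ‖g' τ‖ ^ 2) ≤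
      ∫ τ in (1 : ℝ)..2, (c * ‖g τ‖ ^ 2 + c⁻¹ * ‖g' τ‖ ^ 2) := by
    refine intervalIntegral.integral_mono_interval le_rfl ht.1 ht.2 ?_
      (hcont2.intervalIntegrable _ _)
    exact Filter.Eventually.of_forall fun τ => by positivity
  linarith

/-- A quantitative one-dimensional Sobolev embedding on `[1, 2]`. -/
lemma iSup_enorm_sq_le {g g' : ℝ → ℂ} (hg : ∀ t, HasDerivAt g (g' t) t)
    (hg' : Continuous g') {c : ℝ} (hc : 0 < c) :
    (⨆ t ∈ Set.Ioo (1 : ℝ) 2, ‖g t‖ₑ) ^ 2 ≤ ‖g 1‖ₑ ^ 2 + ∫⁻ τ in Set.Ioc (1 : ℝ) 2,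
      (ENNReal.ofReal c * ‖g τ‖ₑ ^ 2 + ENNReal.ofReal c⁻¹ * ‖g' τ‖ₑ ^ 2) := by
  have hgc : Continuous g := continuous_iff_continuousAt.2 fun t => (hg t).continuousAt
  have hcont2 : Continuous fun τ => c * ‖g τ‖ ^ 2 + c⁻¹ * ‖g' τ‖ ^ 2 := by fun_prop
  have hsq : ∀ z : ℂ, ‖z‖ₑ ^ 2 = ENNReal.ofReal (‖z‖ ^ 2) := fun z => by
    rw [ENNReal.ofReal_pow (norm_nonneg _), ofReal_norm]
  -- Take a square root to free the supremum, bound each `t` separately, then square again.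
  rw [← ENNReal.rpow_natCast, Nat.cast_ofNat, ← ENNReal.le_rpow_inv_iff (by norm_num)]
  refine iSup₂_le fun t ht => ?_
  rw [ENNReal.le_rpow_inv_iff (by norm_num), ENNReal.rpow_two, hsq, hsq]
  have h := norm_sq_le_add_integral hg hg' hc (Set.Ioo_subset_Icc_self ht)
  refine (ENNReal.ofReal_le_ofReal h).trans ?_
  rw [intervalIntegral.integral_of_le one_le_two, ENNReal.ofReal_add (by positivity)
    (integral_nonneg fun τ => by positivity), ofReal_integral_eq_lintegral_ofReal
    ((hcont2.intervalIntegrable 1 2).1) (Filter.Eventually.of_forall fun τ => by positivity)]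
  refine add_le_add le_rfl (lintegral_mono fun τ => ?_)
  rw [ENNReal.ofReal_add (by positivity) (by positivity), ENNReal.ofReal_mul hc.le,
    ENNReal.ofReal_mul (by positivity), hsq, hsq]

end Sobolev

/-! ### The maximal function of a frequency-localized multiplier. -/

section MaximalShell

variable {E : Type*} [NormedAddCommGroup E] [InnerProductSpace ℝ E] [FiniteDimensional ℝ E]
  [MeasurableSpace E] [BorelSpace E]

/-- Joint continuity supplies the measurability needed to exchange the integrals in `x` and `t`. -/
lemma continuous_diagonalFourierInv_mul {m : ℕ} {H : (Fin m → E) → ℂ} {k : (Fin m → E) → ℝ → ℂ}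
    (hH : Integrable H) (hk : Continuous fun p : (Fin m → E) × ℝ => k p.1 p.2) {M : ℝ}
    (hM : ∀ ξ, H ξ ≠ 0 → ∀ t, ‖k ξ t‖ ≤ M) :
    Continuous fun p : E × ℝ => diagonalFourierInv (fun ξ => H ξ * k ξ p.2) p.1 := by
  refine continuous_of_dominated (bound := fun ξ => ‖H ξ‖ * M) (fun p => ?_) (fun p => ?_)
    (hH.norm.mul_const M) ?_
  · refine AEStronglyMeasurable.mul ?_ (hH.aestronglyMeasurable.mul ?_)
    · exact (by fun_prop : Continuous fun ξ : Fin m → E =>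
        (Real.fourierChar (inner ℝ (∑ i, ξ i) p.1) : ℂ)).aestronglyMeasurable
    · exact (hk.comp (Continuous.prodMk_left p.2)).aestronglyMeasurable
  · refine Filter.Eventually.of_forall fun ξ => ?_
    by_cases h : H ξ = 0
    · simp [h]
    · simp only [norm_mul, Circle.norm_coe, one_mul]
      gcongr
      exact hM ξ h _
  · refine Filter.Eventually.of_forall fun ξ => ?_
    have h1 : Continuous fun p : E × ℝ => k ξ p.2 :=
      hk.comp (continuous_const.prodMk continuous_snd)
    fun_prop

lemma continuous_diagonalFourierInv_mul_apply {m : ℕ} {H : (Fin m → E) → ℂ}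
    {k : (Fin m → E) → ℝ → ℂ} (hH : Integrable H)
    (hk : Continuous fun p : (Fin m → E) × ℝ => k p.1 p.2) {M : ℝ}
    (hM : ∀ ξ, H ξ ≠ 0 → ∀ t, ‖k ξ t‖ ≤ M) (t : ℝ) :
    Continuous (diagonalFourierInv fun ξ => H ξ * k ξ t) :=
  (continuous_diagonalFourierInv_mul hH hk hM).comp (Continuous.prodMk_left t)

lemma hasDerivAt_diagonalFourierInv_mul {m : ℕ} {H : (Fin m → E) → ℂ}
    {k k' : (Fin m → E) → ℝ → ℂ} (hH : Integrable H)
    (hk : Continuous fun p : (Fin m → E) × ℝ => k p.1 p.2)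
    (hk' : Continuous fun p : (Fin m → E) × ℝ => k' p.1 p.2)
    (hd : ∀ ξ t, HasDerivAt (k ξ) (k' ξ t) t) {M : ℝ}
    (hM : ∀ ξ, H ξ ≠ 0 → ∀ t, ‖k ξ t‖ ≤ M) (hM' : ∀ ξ, H ξ ≠ 0 → ∀ t, ‖k' ξ t‖ ≤ M)
    (x : E) (t : ℝ) :
    HasDerivAt (fun t => diagonalFourierInv (fun ξ => H ξ * k ξ t) x)
      (diagonalFourierInv (fun ξ => H ξ * k' ξ t) x) t := by
  have hchar : Continuous fun ξ : Fin m → E => (Real.fourierChar (inner ℝ (∑ i, ξ i) x) : ℂ) := by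
    fun_prop
  have hmeas : ∀ {l : (Fin m → E) → ℝ → ℂ},
      (Continuous fun p : (Fin m → E) × ℝ => l p.1 p.2) → ∀ t,
      AEStronglyMeasurable (fun ξ => (Real.fourierChar (inner ℝ (∑ i, ξ i) x) : ℂ) *
        (H ξ * l ξ t)) := fun hl t =>
    hchar.aestronglyMeasurable.mul (hH.aestronglyMeasurable.mul
      (hl.comp (Continuous.prodMk_left t)).aestronglyMeasurable)
  have hbd : ∀ {l : (Fin m → E) → ℝ → ℂ}, (∀ ξ, H ξ ≠ 0 → ∀ t, ‖l ξ t‖ ≤ M) → ∀ t ξ,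
      ‖(Real.fourierChar (inner ℝ (∑ i, ξ i) x) : ℂ) * (H ξ * l ξ t)‖ ≤ ‖H ξ‖ * M := by
    intro l hl t ξ
    by_cases h : H ξ = 0
    · simp [h]
    · simp only [norm_mul, Circle.norm_coe, one_mul]
      gcongr
      exact hl ξ h _
  refine (hasDerivAt_integral_of_dominated_loc_of_deriv_le (bound := fun ξ => ‖H ξ‖ * M)
    Filter.univ_mem (Filter.Eventually.of_forall fun t => hmeas hk t) ?_ (hmeas hk' t)
    (Filter.Eventually.of_forall fun ξ t _ => hbd hM' t ξ) (hH.norm.mul_const M)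
    (Filter.Eventually.of_forall fun ξ t _ => ?_)).2
  · exact (hH.norm.mul_const M).mono' (hmeas hk t) (Filter.Eventually.of_forall (hbd hM t))
  · exact ((hd ξ t).const_mul _).const_mul _

/-- The `L²` bound for the maximal function of a frequency-localized multiplier `k`, in terms of
bounds for the multiplier and its derivative in the dilation parameter. -/
lemma lintegral_iSup_diagonalFourierInv_mul_le (n : ℕ) {R : ℝ} {H : (Fin (n + 1) → E) → ℂ}
    {k k' : (Fin (n + 1) → E) → ℝ → ℂ} (hH : Integrable H)
    (hsupp : ∀ ξ, H ξ ≠ 0 → ∀ i, ‖ξ i‖ ≤ R)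
    (hk : Continuous fun p : (Fin (n + 1) → E) × ℝ => k p.1 p.2)
    (hk' : Continuous fun p : (Fin (n + 1) → E) × ℝ => k' p.1 p.2)
    (hd : ∀ ξ t, HasDerivAt (k ξ) (k' ξ t) t) {M : ℝ}
    (hM : ∀ ξ, H ξ ≠ 0 → ∀ t, ‖k ξ t‖ ≤ M) (hM' : ∀ ξ, H ξ ≠ 0 → ∀ t, ‖k' ξ t‖ ≤ M)
    {a b c : ℝ} (hc : 0 < c)
    (ha : ∀ ξ, H ξ ≠ 0 → ∀ t ∈ Set.Icc (1 : ℝ) 2, ‖k ξ t‖ ≤ a)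
    (hb : ∀ ξ, H ξ ≠ 0 → ∀ t ∈ Set.Icc (1 : ℝ) 2, ‖k' ξ t‖ ≤ b) :
    ∫⁻ x, (⨆ t ∈ Set.Ioo (1 : ℝ) 2, ‖diagonalFourierInv (fun ξ => H ξ * k ξ t) x‖ₑ) ^ 2 ≤
      ENNReal.ofReal (a ^ 2 + c * a ^ 2 + c⁻¹ * b ^ 2) *
        (volume (Metric.closedBall (0 : E) R) ^ n * ∫⁻ ξ, ‖H ξ‖ₑ ^ 2) := by
  set K := volume (Metric.closedBall (0 : E) R) ^ n * ∫⁻ ξ, ‖H ξ‖ₑ ^ 2 with hK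
  have hfix : ∀ {l : (Fin (n + 1) → E) → ℝ → ℂ},
      (Continuous fun p : (Fin (n + 1) → E) × ℝ => l p.1 p.2) →
      (∀ ξ, H ξ ≠ 0 → ∀ t, ‖l ξ t‖ ≤ M) → ∀ {A : ℝ} {t : ℝ}, (∀ ξ, H ξ ≠ 0 → ‖l ξ t‖ ≤ A) →
      ∫⁻ x, ‖diagonalFourierInv (fun ξ => H ξ * l ξ t) x‖ₑ ^ 2 ≤ ENNReal.ofReal (A ^ 2) * K := by
    intro l hl hlM A t hA
    have hint : Integrable fun ξ => H ξ * l ξ t := by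
      refine (hH.norm.mul_const M).mono' (hH.aestronglyMeasurable.mul
        (hl.comp (Continuous.prodMk_left t)).aestronglyMeasurable)
        (Filter.Eventually.of_forall fun ξ => ?_)
      by_cases h : H ξ = 0
      · simp [h]
      · rw [norm_mul]
        gcongr
        exact hlM ξ h t
    refine (lintegral_enorm_sq_diagonalFourierInv_le n hint
      fun ξ h => hsupp ξ (left_ne_zero_of_mul h)).trans ?_
    rw [hK, mul_left_comm, ← lintegral_const_mul' _ _ ENNReal.ofReal_ne_top]
    gcongr with ξ
    by_cases h : H ξ = 0
    · simp [h]
    · rw [enorm_mul, mul_pow, mul_comm, ENNReal.ofReal_pow ((norm_nonneg _).trans (hA ξ h))]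
      gcongr
      rw [← ofReal_norm]
      exact ENNReal.ofReal_le_ofReal (hA ξ h)
  have hcA := continuous_diagonalFourierInv_mul hH hk hM
  have hcD := continuous_diagonalFourierInv_mul hH hk' hM'
  have hcAt : ∀ t : ℝ, Continuous (diagonalFourierInv fun ξ => H ξ * k ξ t) :=
    continuous_diagonalFourierInv_mul_apply hH hk hM
  have hmA := (hcA.enorm.measurable.pow_const 2).const_mul (ENNReal.ofReal c)
  have hmD := (hcD.enorm.measurable.pow_const 2).const_mul (ENNReal.ofReal c⁻¹)
  -- Apply Sobolev at each `x`, exchange the integrals by Tonelli, then use the trace inequality at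
  -- each fixed `τ`.
  calc _ ≤ ∫⁻ x, (‖diagonalFourierInv (fun ξ => H ξ * k ξ 1) x‖ₑ ^ 2 +
        ∫⁻ τ in Set.Ioc (1 : ℝ) 2,
          (ENNReal.ofReal c * ‖diagonalFourierInv (fun ξ => H ξ * k ξ τ) x‖ₑ ^ 2 +
            ENNReal.ofReal c⁻¹ * ‖diagonalFourierInv (fun ξ => H ξ * k' ξ τ) x‖ₑ ^ 2)) := by
        refine lintegral_mono fun x => ?_
        exact iSup_enorm_sq_le (hasDerivAt_diagonalFourierInv_mul hH hk hk' hd hM hM' x)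
          (hcD.comp (Continuous.prodMk_right x)) hc
    _ = (∫⁻ x, ‖diagonalFourierInv (fun ξ => H ξ * k ξ 1) x‖ₑ ^ 2) +
        ∫⁻ τ in Set.Ioc (1 : ℝ) 2,
          (ENNReal.ofReal c * (∫⁻ x, ‖diagonalFourierInv (fun ξ => H ξ * k ξ τ) x‖ₑ ^ 2) +
            ENNReal.ofReal c⁻¹ *
              ∫⁻ x, ‖diagonalFourierInv (fun ξ => H ξ * k' ξ τ) x‖ₑ ^ 2) := by
        rw [lintegral_add_left]
        · congr 1
          rw [lintegral_lintegral_swap (hmA.add hmD).aemeasurable]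
          refine lintegral_congr fun τ => ?_
          rw [lintegral_add_left, lintegral_const_mul' _ _ ENNReal.ofReal_ne_top,
            lintegral_const_mul' _ _ ENNReal.ofReal_ne_top]
          exact ((hcAt τ).enorm.measurable.pow_const 2).const_mul _
        · exact (hcAt 1).enorm.measurable.pow_const 2
    _ ≤ ENNReal.ofReal (a ^ 2) * K + ∫⁻ τ in Set.Ioc (1 : ℝ) 2,
          (ENNReal.ofReal c * (ENNReal.ofReal (a ^ 2) * K) +
            ENNReal.ofReal c⁻¹ * (ENNReal.ofReal (b ^ 2) * K)) := by
        refine add_le_add (hfix hk hM fun ξ h => ha ξ h 1 (by norm_num)) ?_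
        refine setLIntegral_mono measurable_const fun τ hτ => ?_
        have hτ' := Set.Ioc_subset_Icc_self hτ
        gcongr
        · exact hfix hk hM fun ξ h => ha ξ h τ hτ'
        · exact hfix hk' hM' fun ξ h => hb ξ h τ hτ'
    _ = _ := by
        rw [setLIntegral_const, Real.volume_Ioc, ENNReal.ofReal_add (by positivity)
          (by positivity), ENNReal.ofReal_add (by positivity) (by positivity),
          ENNReal.ofReal_mul hc.le, ENNReal.ofReal_mul (by positivity)]
        norm_num
        ring

end MaximalShell

/-! ### Decay and regularity of `σ̂(tξ)` and of its `t`-derivative. -/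

section Decay

variable {m d : ℕ}

lemma measureFourier_eq (σ : Measure (Rmd m d)) (ξ : Rmd m d) :
    measureFourier σ ξ = ∫ y, (Real.fourierChar (-inner ℝ y ξ) : ℂ) ∂σ := by
  refine integral_congr_ae (Filter.Eventually.of_forall fun y => ?_)
  simp only [Real.fourierChar_apply]
  congr 1
  push_cast
  ring

/-- The derivative of `t ↦ σ̂(tξ)`. -/
noncomputable def measureFourierDeriv (σ : Measure (Rmd m d)) (ξ : Rmd m d) (t : ℝ) : ℂ :=
  ∫ y, (-(2 * Real.pi * inner ℝ y ξ : ℝ) * Complex.I) *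
    (Real.fourierChar (-inner ℝ y (t • ξ)) : ℂ) ∂σ

/-- Peetre's inequality: it lets the decay of `σ̂` survive convolution with a rapidly decreasing
function. -/
lemma one_add_norm_rpow_neg_sub_le {V : Type*} [SeminormedAddCommGroup V] {s : ℝ} (hs : 0 ≤ s)
    (ζ v : V) :
    (1 + ‖ζ - v‖) ^ (-s) ≤ (1 + ‖ζ‖) ^ (-s) * (1 + ‖v‖) ^ s := by
  have h1 : 1 + ‖ζ‖ ≤ (1 + ‖ζ - v‖) * (1 + ‖v‖) := by
    have := norm_add_le (ζ - v) v
    rw [sub_add_cancel] at this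
    nlinarith [norm_nonneg (ζ - v), norm_nonneg v]
  have h2 := Real.rpow_le_rpow (by positivity) h1 hs
  rw [Real.mul_rpow (by positivity) (by positivity)] at h2
  rw [Real.rpow_neg (by positivity), Real.rpow_neg (by positivity), inv_mul_eq_div,
    le_div_iff₀ (by positivity), inv_mul_le_iff₀ (by positivity)]
  exact h2

lemma integrable_norm_mul_one_add_norm_rpow {V : Type*} [NormedAddCommGroup V]
    [InnerProductSpace ℝ V] [FiniteDimensional ℝ V] [MeasurableSpace V] [BorelSpace V]
    (φ : 𝓢(V, ℂ)) (s : ℝ) :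
    Integrable fun v => ‖φ v‖ * (1 + ‖v‖) ^ s := by
  obtain ⟨k, hk⟩ := exists_nat_ge s
  have hint : Integrable fun v => 2 ^ (k - 1) * (‖φ v‖ + ‖v‖ ^ k * ‖φ v‖) :=
    (φ.integrable.norm.add (φ.integrable_pow_mul volume k)).const_mul _
  refine hint.mono' ?_ (Filter.Eventually.of_forall fun v => ?_)
  · refine Continuous.aestronglyMeasurable ?_
    refine φ.continuous.norm.mul (Continuous.rpow_const (by fun_prop) fun v => Or.inl ?_)
    positivity
  · rw [Real.norm_of_nonneg (by positivity)]
    have h1 : (1 + ‖v‖) ^ s ≤ (1 + ‖v‖) ^ k := by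
      rw [← Real.rpow_natCast]
      exact Real.rpow_le_rpow_of_exponent_le (by linarith [norm_nonneg v]) hk
    have h2 := add_pow_le zero_le_one (norm_nonneg v) k
    rw [one_pow] at h2
    calc _ ≤ ‖φ v‖ * (2 ^ (k - 1) * (1 + ‖v‖ ^ k)) := by
          gcongr
          exact h1.trans h2
      _ = _ := by ring

lemma schwartz_eq_integral_fourierChar {V : Type*} [NormedAddCommGroup V] [InnerProductSpace ℝ V]
    [FiniteDimensional ℝ V] [MeasurableSpace V] [BorelSpace V] (ψ : 𝓢(V, ℂ)) (y : V) :
    ψ y = ∫ v, (Real.fourierChar (inner ℝ v y) : ℂ) * (𝓕 ψ) v := by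
  have h1 : ψ = 𝓕⁻ (𝓕 ψ) := by simp
  conv_lhs => rw [h1]
  rw [SchwartzMap.fourierInv_coe, Real.fourierInv_eq]
  simp [Circle.smul_def]

/-- Multiplying a measure by a Schwartz function preserves the decay of its Fourier transform. -/
lemma exists_norm_integral_schwartz_mul_fourierChar_le {s A : ℝ} (hs : 0 ≤ s)
    (σ : Measure (Rmd m d)) [IsFiniteMeasure σ]
    (hdecay : ∀ ξ : Rmd m d, ‖measureFourier σ ξ‖ ≤ A * (1 + ‖ξ‖) ^ (-s))
    (ψ : 𝓢(Rmd m d, ℂ)) :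
    ∃ C : ℝ, 0 ≤ C ∧ ∀ ζ : Rmd m d,
      ‖∫ y, ψ y * (Real.fourierChar (-inner ℝ y ζ) : ℂ) ∂σ‖ ≤ C * (1 + ‖ζ‖) ^ (-s) := by
  have hA : 0 ≤ A := by
    have := (norm_nonneg _).trans (hdecay 0)
    simpa using this
  refine ⟨A * ∫ v, ‖(𝓕 ψ) v‖ * (1 + ‖v‖) ^ s, mul_nonneg hA (integral_nonneg fun v => by positivity),
    fun ζ => ?_⟩
  have hint : Integrable (fun p : Rmd m d × Rmd m d =>
      ((Real.fourierChar (inner ℝ p.2 p.1) : ℂ) * (𝓕 ψ) p.2) *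
        (Real.fourierChar (-inner ℝ p.1 ζ) : ℂ)) (σ.prod volume) := by
    have h0 : Integrable (fun p : Rmd m d × Rmd m d => (1 : ℂ) * (𝓕 ψ) p.2) (σ.prod volume) :=
      (integrable_const (1 : ℂ)).mul_prod (𝓕 ψ).integrable
    refine h0.mono ?_ (Filter.Eventually.of_forall fun p => ?_)
    · have hc : Continuous fun p : Rmd m d × Rmd m d => (𝓕 ψ) p.2 :=
        (𝓕 ψ).continuous.comp continuous_snd
      exact Continuous.aestronglyMeasurable (by fun_prop)
    · rw [norm_mul, norm_mul, norm_mul, Circle.norm_coe, Circle.norm_coe]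
      simp
  -- The Fourier transform of `ψσ` is the convolution of `ψ̂` with `σ̂`.
  have hswap : ∫ y, ψ y * (Real.fourierChar (-inner ℝ y ζ) : ℂ) ∂σ =
      ∫ v, (𝓕 ψ) v * measureFourier σ (ζ - v) := by
    calc _ = ∫ y, (∫ v, ((Real.fourierChar (inner ℝ v y) : ℂ) * (𝓕 ψ) v) *
          (Real.fourierChar (-inner ℝ y ζ) : ℂ)) ∂σ := by
          congr 1
          ext y
          rw [integral_mul_const, ← schwartz_eq_integral_fourierChar]
      _ = ∫ v, ∫ y, ((Real.fourierChar (inner ℝ v y) : ℂ) * (𝓕 ψ) v) *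
          (Real.fourierChar (-inner ℝ y ζ) : ℂ) ∂σ := integral_integral_swap hint
      _ = _ := by
          refine integral_congr_ae (Filter.Eventually.of_forall fun v => ?_)
          simp only [measureFourier_eq]
          rw [← integral_const_mul]
          refine integral_congr_ae (Filter.Eventually.of_forall fun y => ?_)
          have : -inner ℝ y (ζ - v) = inner ℝ v y + -inner ℝ y ζ := by
            rw [inner_sub_right, real_inner_comm y v]; ring
          simp only [this, AddChar.map_add_eq_mul, Circle.coe_mul]
          ring
  rw [hswap]
  have hI := (integrable_norm_mul_one_add_norm_rpow (𝓕 ψ) s).const_mul (A * (1 + ‖ζ‖) ^ (-s))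
  calc _ ≤ ∫ v, A * (1 + ‖ζ‖) ^ (-s) * (‖(𝓕 ψ) v‖ * (1 + ‖v‖) ^ s) := by
        refine norm_integral_le_of_norm_le hI (Filter.Eventually.of_forall fun v => ?_)
        rw [norm_mul]
        calc _ ≤ ‖(𝓕 ψ) v‖ * (A * ((1 + ‖ζ‖) ^ (-s) * (1 + ‖v‖) ^ s)) := by
              gcongr
              refine (hdecay _).trans ?_
              gcongr
              exact one_add_norm_rpow_neg_sub_le hs ζ v
          _ = _ := by ring
    _ = _ := by
        rw [integral_const_mul]
        ring

/-- Expand `⟪y, ξ⟫` in an orthonormal basis: each coordinate of `y`, cut off by a bump equal to `1`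
on the unit ball, is a Schwartz function, so the previous estimate applies term by term. -/
lemma exists_norm_measureFourierDeriv_le {s A : ℝ} (hs : 0 ≤ s)
    (σ : Measure (Rmd m d)) [IsFiniteMeasure σ]
    (hsupp : σ (Metric.closedBall (0 : Rmd m d) 1)ᶜ = 0)
    (hdecay : ∀ ξ : Rmd m d, ‖measureFourier σ ξ‖ ≤ A * (1 + ‖ξ‖) ^ (-s)) :
    ∃ C : ℝ, 0 ≤ C ∧ ∀ (ξ : Rmd m d) (t : ℝ),
      ‖measureFourierDeriv σ ξ t‖ ≤ C * ‖ξ‖ * (1 + ‖t • ξ‖) ^ (-s) := by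
  let b := stdOrthonormalBasis ℝ (Rmd m d)
  let χ : ContDiffBump (0 : Rmd m d) := ⟨1, 2, one_pos, one_lt_two⟩
  have hχs : ContDiff ℝ ∞ fun x => (χ x : ℂ) := Complex.ofRealCLM.contDiff.comp χ.contDiff
  have hχc : HasCompactSupport fun x => (χ x : ℂ) :=
    HasCompactSupport.comp_left (g := Complex.ofReal) χ.hasCompactSupport Complex.ofReal_zero
  have hls : ∀ j, ContDiff ℝ ∞ fun y : Rmd m d => ((inner ℝ y (b j) : ℝ) : ℂ) * (χ y : ℂ) :=
    fun j => (Complex.ofRealCLM.contDiff.comp (contDiff_id.inner ℝ contDiff_const)).mul hχs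
  let ψ : ∀ _ : Fin (Module.finrank ℝ (Rmd m d)), 𝓢(Rmd m d, ℂ) :=
    fun j => hχc.mul_left.toSchwartzMap (hls j)
  have hψ : ∀ j y, ψ j y = ((inner ℝ y (b j) : ℝ) : ℂ) * (χ y : ℂ) := fun j y => rfl
  choose C hC0 hC using fun j =>
    exists_norm_integral_schwartz_mul_fourierChar_le hs σ hdecay (ψ j)
  refine ⟨2 * Real.pi * ∑ j, C j, by have := Finset.univ.sum_nonneg fun j _ => hC0 j; positivity,
    fun ξ t => ?_⟩
  have hae : ∀ᵐ y ∂σ, y ∈ Metric.closedBall (0 : Rmd m d) 1 := by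
    rw [ae_iff]; exact hsupp
  have hint : ∀ j, Integrable (fun y => ψ j y * (Real.fourierChar (-inner ℝ y (t • ξ)) : ℂ)) σ := by
    intro j
    refine ((ψ j).integrable (μ := σ)).mono ?_ (Filter.Eventually.of_forall fun y => by
      rw [norm_mul, Circle.norm_coe, mul_one])
    have := (ψ j).continuous
    exact Continuous.aestronglyMeasurable (by fun_prop)
  have heq : measureFourierDeriv σ ξ t = ∑ j, (-(2 * Real.pi * inner ℝ (b j) ξ : ℝ) * Complex.I) *
      ∫ y, ψ j y * (Real.fourierChar (-inner ℝ y (t • ξ)) : ℂ) ∂σ := by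
    simp_rw [← integral_const_mul]
    rw [← integral_finsetSum _ fun j _ => (hint j).const_mul _]
    refine integral_congr_ae (hae.mono fun y hy => ?_)
    simp only [hψ, χ.one_of_mem_closedBall hy]
    rw [← b.sum_inner_mul_inner y ξ]
    push_cast
    simp only [Finset.mul_sum, Finset.sum_mul, ← Finset.sum_neg_distrib]
    exact Finset.sum_congr rfl fun j _ => by ring
  rw [heq]
  refine (norm_sum_le _ _).trans ?_
  calc _ ≤ ∑ j, 2 * Real.pi * ‖ξ‖ * (C j * (1 + ‖t • ξ‖) ^ (-s)) := by
        refine Finset.sum_le_sum fun j _ => ?_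
        rw [norm_mul]
        gcongr
        · rw [norm_mul, norm_neg, Complex.norm_I, mul_one, Complex.norm_real, norm_mul, norm_mul,
            Real.norm_of_nonneg Real.pi_pos.le]
          rw [Real.norm_ofNat, Real.norm_eq_abs]
          gcongr
          have := abs_real_inner_le_norm (b j) ξ
          rw [b.norm_eq_one, one_mul] at this
          exact this
        · exact hC j _
    _ = _ := by
        simp only [Finset.mul_sum, Finset.sum_mul]
        exact Finset.sum_congr rfl fun j _ => by ring

section Deriv

variable (σ : Measure (Rmd m d)) [IsFiniteMeasure σ]

lemma norm_measureFourier_le (ξ : Rmd m d) : ‖measureFourier σ ξ‖ ≤ σ.real Set.univ := by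
  rw [measureFourier_eq]
  refine (norm_integral_le_of_norm_le_const (C := 1) (Filter.Eventually.of_forall fun y => ?_)).trans
    (by simp)
  exact (Circle.norm_coe _).le

lemma continuous_measureFourier : Continuous (measureFourier σ) := by
  have : measureFourier σ = fun ξ => ∫ y, (Real.fourierChar (-inner ℝ y ξ) : ℂ) ∂σ :=
    funext (measureFourier_eq σ)
  rw [this]
  refine continuous_of_dominated (bound := fun _ => 1) (fun ξ => ?_) (fun ξ => ?_)
    (integrable_const _) ?_
  · exact Continuous.aestronglyMeasurable (by fun_prop)
  · exact Filter.Eventually.of_forall fun y => (Circle.norm_coe _).le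
  · exact Filter.Eventually.of_forall fun y => by fun_prop

variable {σ}

lemma norm_measureFourierDeriv_integrand_le {y : Rmd m d}
    (hy : y ∈ Metric.closedBall (0 : Rmd m d) 1) (ξ : Rmd m d) (t : ℝ) :
    ‖(-(2 * Real.pi * inner ℝ y ξ : ℝ) * Complex.I) *
      (Real.fourierChar (-inner ℝ y (t • ξ)) : ℂ)‖ ≤ 2 * Real.pi * ‖ξ‖ := by
  rw [mem_closedBall_zero_iff] at hy
  rw [norm_mul, norm_mul, norm_neg, Complex.norm_I, Complex.norm_real, Circle.norm_coe, mul_one,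
    mul_one, norm_mul, norm_mul, Real.norm_of_nonneg Real.pi_pos.le, Real.norm_ofNat]
  gcongr
  refine (norm_inner_le_norm y ξ).trans ?_
  exact mul_le_of_le_one_left (norm_nonneg _) hy

variable (hsupp : σ (Metric.closedBall (0 : Rmd m d) 1)ᶜ = 0)
include hsupp

lemma norm_measureFourierDeriv_le (ξ : Rmd m d) (t : ℝ) :
    ‖measureFourierDeriv σ ξ t‖ ≤ 2 * Real.pi * ‖ξ‖ * σ.real Set.univ := by
  have hae : ∀ᵐ y ∂σ, y ∈ Metric.closedBall (0 : Rmd m d) 1 := by rw [ae_iff]; exact hsupp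
  exact norm_integral_le_of_norm_le_const
    (hae.mono fun y hy => norm_measureFourierDeriv_integrand_le hy ξ t)

lemma continuous_measureFourierDeriv :
    Continuous fun p : Rmd m d × ℝ => measureFourierDeriv σ p.1 p.2 := by
  have hae : ∀ᵐ y ∂σ, y ∈ Metric.closedBall (0 : Rmd m d) 1 := by rw [ae_iff]; exact hsupp
  refine continuous_iff_continuousAt.2 fun p₀ => ?_
  -- The bound on the integrand grows with `‖ξ‖`, so domination is available only locally.
  have hnear : ∀ᶠ p : Rmd m d × ℝ in nhds p₀, ‖p.1‖ < ‖p₀.1‖ + 1 :=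
    continuous_fst.norm.continuousAt.eventually_lt continuousAt_const (by simp)
  refine continuousAt_of_dominated (bound := fun _ => 2 * Real.pi * (‖p₀.1‖ + 1))
    (Filter.Eventually.of_forall fun p => ?_) (hnear.mono fun p hp => hae.mono fun y hy => ?_)
    (integrable_const _) ?_
  · exact Continuous.aestronglyMeasurable (by fun_prop)
  · refine (norm_measureFourierDeriv_integrand_le hy _ _).trans ?_
    gcongr
  · exact Filter.Eventually.of_forall fun y => Continuous.continuousAt (by fun_prop)

lemma hasDerivAt_measureFourier_smul (ξ : Rmd m d) (t : ℝ) :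
    HasDerivAt (fun t : ℝ => measureFourier σ (t • ξ)) (measureFourierDeriv σ ξ t) t := by
  have hae : ∀ᵐ y ∂σ, y ∈ Metric.closedBall (0 : Rmd m d) 1 := by rw [ae_iff]; exact hsupp
  simp_rw [measureFourier_eq]
  refine (hasDerivAt_integral_of_dominated_loc_of_deriv_le (bound := fun _ => 2 * Real.pi * ‖ξ‖)
    Filter.univ_mem (Filter.Eventually.of_forall fun t => ?_) ?_ ?_
    (hae.mono fun y hy t _ => norm_measureFourierDeriv_integrand_le hy ξ t) (integrable_const _)
    (Filter.Eventually.of_forall fun y t _ => ?_)).2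
  · exact Continuous.aestronglyMeasurable (by fun_prop)
  · refine (integrable_const (1 : ℝ)).mono' (Continuous.aestronglyMeasurable (by fun_prop))
      (Filter.Eventually.of_forall fun y => (Circle.norm_coe _).le)
  · exact Continuous.aestronglyMeasurable (by fun_prop)
  · have h1 : HasDerivAt (fun t : ℝ => -inner ℝ y (t • ξ)) (-inner ℝ y ξ) t := by
      simp_rw [real_inner_smul_right]
      exact ((hasDerivAt_mul_const (inner ℝ y ξ)).neg)
    have h2 := (Real.hasDerivAt_fourierChar (-inner ℝ y (t • ξ))).scomp t h1
    refine h2.congr_deriv ?_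
    rw [Complex.real_smul]
    push_cast
    ring

end Deriv

end Decay

/-! ### The average as a diagonal Fourier integral. -/

section Representation

variable {m d : ℕ}

/-- The Fourier transform of the tensor product `f₁ ⊗ ⋯ ⊗ fₘ`. -/
noncomputable def tensorFourier (f : Fin m → 𝓢(Rd d, ℂ)) (ξ : Fin m → Rd d) : ℂ :=
  ∏ i, (𝓕 (f i)) (ξ i)

lemma integrable_tensorFourier (f : Fin m → 𝓢(Rd d, ℂ)) : Integrable (tensorFourier f) :=
  Integrable.fintype_prod (f := fun i (v : Rd d) => (𝓕 (f i)) v) fun i => (𝓕 (f i)).integrable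

lemma continuous_tensorFourier (f : Fin m → 𝓢(Rd d, ℂ)) : Continuous (tensorFourier f) :=
  continuous_finsetProd _ fun i _ => (𝓕 (f i)).continuous.comp (continuous_apply i)

lemma lintegral_enorm_sq_tensorFourier (f : Fin m → 𝓢(Rd d, ℂ)) :
    ∫⁻ ξ, ‖tensorFourier f ξ‖ₑ ^ 2 = ∏ i, ∫⁻ x, ‖f i x‖ₑ ^ 2 := by
  have hint : ∀ i, Integrable fun x => ‖(𝓕 (f i)) x‖ ^ 2 :=
    fun i => ((𝓕 (f i)).memLp 2).integrable_norm_pow (by norm_num)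
  have h1 : ∫⁻ ξ, ‖tensorFourier f ξ‖ₑ ^ 2 =
      ENNReal.ofReal (∫ ξ : Fin m → Rd d, ∏ i, ‖(𝓕 (f i)) (ξ i)‖ ^ 2) := by
    rw [ofReal_integral_eq_lintegral_ofReal]
    · refine lintegral_congr fun ξ => ?_
      rw [Finset.prod_pow, ENNReal.ofReal_pow (by positivity), ← norm_prod, ofReal_norm]
      rfl
    · exact Integrable.fintype_prod (f := fun i (x : Rd d) => ‖(𝓕 (f i)) x‖ ^ 2) hint
    · exact Filter.Eventually.of_forall fun x => by positivity
  rw [h1, integral_fintype_prod_volume_eq_prod (fun (i : Fin m) (x : Rd d) => ‖(𝓕 (f i) : 𝓢(Rd d, ℂ)) x‖ ^ 2),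
    ENNReal.ofReal_prod_of_nonneg fun i _ => integral_nonneg fun x => by positivity]
  refine Finset.prod_congr rfl fun i _ => ?_
  rw [SchwartzMap.integral_norm_sq_fourier, lintegral_enorm_sq_schwartz]

lemma prod_schwartz_eq_integral (f : Fin m → 𝓢(Rd d, ℂ)) (x : Rd d) (t : ℝ) (y : Rmd m d) :
    ∏ i, f i (x - t • y i) = ∫ ξ : Fin m → Rd d,
      (Real.fourierChar (inner ℝ (∑ i, ξ i) x) : ℂ) * (tensorFourier f ξ *
        (Real.fourierChar (-inner ℝ y (t • WithLp.toLp 2 ξ)) : ℂ)) := by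
  have h1 : ∀ i, f i (x - t • y i) =
      ∫ v, (Real.fourierChar (inner ℝ v (x - t • y i)) : ℂ) * (𝓕 (f i)) v :=
    fun i => schwartz_eq_integral_fourierChar (f i) _
  simp_rw [h1]
  rw [← integral_fintype_prod_volume_eq_prod
    (fun (i : Fin m) (v : Rd d) => (Real.fourierChar (inner ℝ v (x - t • y i)) : ℂ) * (𝓕 (f i) : 𝓢(Rd d, ℂ)) v)]
  congr 1
  ext ξ
  have h2 : ∏ i, (Real.fourierChar (inner ℝ (ξ i) (x - t • y i)) : ℂ) =
      (Real.fourierChar (inner ℝ (∑ i, ξ i) x) : ℂ) *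
        (Real.fourierChar (-inner ℝ y (t • WithLp.toLp 2 ξ)) : ℂ) := by
    have h3 : inner ℝ (∑ i, ξ i) x + -inner ℝ y (t • WithLp.toLp 2 ξ) =
        ∑ i, inner ℝ (ξ i) (x - t • y i) := by
      rw [sum_inner, PiLp.inner_apply, ← Finset.sum_neg_distrib, ← Finset.sum_add_distrib]
      refine Finset.sum_congr rfl fun i _ => ?_
      rw [inner_sub_right, PiLp.smul_apply, real_inner_smul_right, real_inner_smul_right,
        real_inner_comm (y i)]
      ring
    rw [← Circle.coe_mul, ← AddChar.map_add_eq_mul, h3]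
    simp only [Real.fourierChar_apply, ← Complex.exp_sum]
    congr 1
    push_cast
    simp only [Finset.mul_sum, Finset.sum_mul]
  rw [Finset.prod_mul_distrib, h2, tensorFourier]
  ring

lemma multiAverage_eq_diagonalFourierInv (σ : Measure (Rmd m d)) [IsFiniteMeasure σ]
    (f : Fin m → 𝓢(Rd d, ℂ)) (x : Rd d) (t : ℝ) :
    multiAverage σ f x t = diagonalFourierInv
      (fun ξ => tensorFourier f ξ * measureFourier σ (t • WithLp.toLp 2 ξ)) x := by
  have hint : Integrable (fun p : Rmd m d × (Fin m → Rd d) =>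
      (Real.fourierChar (inner ℝ (∑ i, p.2 i) x) : ℂ) * (tensorFourier f p.2 *
        (Real.fourierChar (-inner ℝ p.1 (t • WithLp.toLp 2 p.2)) : ℂ))) (σ.prod volume) := by
    have h0 : Integrable (fun p : Rmd m d × (Fin m → Rd d) => (1 : ℂ) * tensorFourier f p.2)
        (σ.prod volume) :=
      (integrable_const (1 : ℂ)).mul_prod (integrable_tensorFourier f)
    refine h0.mono ?_ (Filter.Eventually.of_forall fun p => ?_)
    · have hc : Continuous fun p : Rmd m d × (Fin m → Rd d) => tensorFourier f p.2 :=
        (continuous_tensorFourier f).comp continuous_snd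
      exact Continuous.aestronglyMeasurable (by fun_prop)
    · rw [norm_mul, norm_mul, norm_mul, Circle.norm_coe, Circle.norm_coe]
      simp
  simp only [multiAverage, prod_schwartz_eq_integral]
  refine (integral_integral_swap hint).trans ?_
  refine integral_congr_ae (Filter.Eventually.of_forall fun ξ => ?_)
  simp only [measureFourier_eq]
  rw [integral_const_mul, integral_const_mul]

lemma measurable_iSup_enorm {g : Rd d → ℝ → ℂ} (hg : ∀ t, Continuous fun x => g x t) :
    Measurable fun x => ⨆ t ∈ Set.Ioo (1 : ℝ) 2, ‖g x t‖ₑ :=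
  (lowerSemicontinuous_biSup fun t _ => (hg t).enorm.lowerSemicontinuous).measurable

end Representation

/-! ### Summing geometrically decaying `L²` bounds. -/

section Summation

/-- Cauchy–Schwarz applied to `u j = r^{j/2} · r^{-j/2} u j`. -/
lemma ENNReal.sq_tsum_le {r : ℝ≥0∞} (hr0 : r ≠ 0) (hr1 : r < 1) (u : ℕ → ℝ≥0∞) :
    (∑' j, u j) ^ 2 ≤ (1 - r)⁻¹ * ∑' j, (r ^ j)⁻¹ * u j ^ 2 := by
  have hr : ∀ j : ℕ, r ^ j ≠ 0 := fun j => pow_ne_zero _ hr0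
  have hr' : ∀ j : ℕ, r ^ j ≠ ⊤ := fun j => ENNReal.pow_ne_top (hr1.trans_le le_top).ne
  have h := ENNReal.lintegral_mul_le_Lp_mul_Lq (Measure.count : Measure ℕ)
    Real.HolderConjugate.two_two (f := fun j => (r ^ j) ^ (1 / 2 : ℝ))
    (g := fun j => (r ^ j) ^ (-(1 / 2) : ℝ) * u j) (measurable_of_countable _).aemeasurable
    (measurable_of_countable _).aemeasurable
  simp only [Pi.mul_apply, lintegral_count] at h
  have h1 : ∀ j, (r ^ j) ^ (1 / 2 : ℝ) * ((r ^ j) ^ (-(1 / 2) : ℝ) * u j) = u j := by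
    intro j
    rw [← mul_assoc, ← ENNReal.rpow_add _ _ (hr j) (hr' j)]
    simp
  have h2 : ∀ j, ((r ^ j) ^ (1 / 2 : ℝ)) ^ (2 : ℝ) = r ^ j := by
    intro j
    rw [← ENNReal.rpow_mul]
    norm_num
  have h3 : ∀ j, ((r ^ j) ^ (-(1 / 2) : ℝ) * u j) ^ (2 : ℝ) = (r ^ j)⁻¹ * u j ^ 2 := by
    intro j
    rw [ENNReal.mul_rpow_of_nonneg _ _ (by norm_num), ← ENNReal.rpow_mul, ENNReal.rpow_two]
    norm_num [ENNReal.rpow_neg_one]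
  simp only [h1, h2, h3] at h
  rw [ENNReal.tsum_geometric] at h
  calc _ ≤ _ := pow_le_pow_left' h 2
    _ = _ := by
      rw [mul_pow, ← ENNReal.rpow_natCast, ← ENNReal.rpow_natCast, ← ENNReal.rpow_mul,
        ← ENNReal.rpow_mul]
      norm_num

/-- The decay `r^{2j}` beats the weight `r^{-j}` and leaves a second geometric series. -/
lemma lintegral_tsum_sq_le {α : Type*} [MeasurableSpace α] {μ : Measure α} {u : ℕ → α → ℝ≥0∞}
    (hu : ∀ j, Measurable (u j)) {r B : ℝ≥0∞} (hr0 : r ≠ 0) (hr1 : r < 1)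
    (hB : ∀ j, ∫⁻ x, u j x ^ 2 ∂μ ≤ B * (r ^ j) ^ 2) :
    ∫⁻ x, (∑' j, u j x) ^ 2 ∂μ ≤ (1 - r)⁻¹ ^ 2 * B := by
  have hr : ∀ j : ℕ, r ^ j ≠ 0 := fun j => pow_ne_zero _ hr0
  have hr' : ∀ j : ℕ, r ^ j ≠ ⊤ := fun j => ENNReal.pow_ne_top (hr1.trans_le le_top).ne
  have h1r : (1 - r)⁻¹ ≠ ⊤ := ENNReal.inv_ne_top.2 (tsub_pos_of_lt hr1).ne'
  calc _ ≤ ∫⁻ x, (1 - r)⁻¹ * ∑' j, (r ^ j)⁻¹ * u j x ^ 2 ∂μ :=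
        lintegral_mono fun x => ENNReal.sq_tsum_le hr0 hr1 _
    _ = (1 - r)⁻¹ * ∑' j, (r ^ j)⁻¹ * ∫⁻ x, u j x ^ 2 ∂μ := by
        rw [lintegral_const_mul' _ _ h1r, lintegral_tsum
          fun j => (((hu j).pow_const 2).const_mul _).aemeasurable]
        simp_rw [lintegral_const_mul' _ _ (ENNReal.inv_ne_top.2 (hr _))]
    _ ≤ (1 - r)⁻¹ * ∑' j, B * r ^ j := by
        gcongr (1 - r)⁻¹ * ∑' j, ?_ with j
        calc _ ≤ (r ^ j)⁻¹ * (B * (r ^ j) ^ 2) := by gcongr; exact hB j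
          _ = ((r ^ j)⁻¹ * r ^ j) * (B * r ^ j) := by ring
          _ = _ := by rw [ENNReal.inv_mul_cancel (hr j) (hr' j), one_mul]
    _ = _ := by
        rw [ENNReal.tsum_mul_left, ENNReal.tsum_geometric]
        ring

end Summation

/-! ### Dyadic decomposition and the global `L²` bound. -/

section GlobalL2

variable {m d : ℕ}

/-- The frequency shell `2^j ≤ 1 + |ξ| < 2^(j+1)`. -/
def frequencyShell (m d : ℕ) (j : ℕ) : Set (Fin m → Rd d) :=
  {ξ | 1 + ‖WithLp.toLp 2 ξ‖ ∈ Set.Ico ((2 : ℝ) ^ j) (2 ^ (j + 1))}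

lemma measurableSet_frequencyShell (j : ℕ) : MeasurableSet (frequencyShell m d j) := by
  have : Continuous fun ξ : Fin m → Rd d => 1 + ‖WithLp.toLp 2 ξ‖ := by fun_prop
  exact this.measurable measurableSet_Ico

lemma pairwise_disjoint_frequencyShell :
    Pairwise (Function.onFun Disjoint (frequencyShell m d)) := by
  have h := (pow_right_mono₀ (one_le_two (α := ℝ))).pairwise_disjoint_on_Ico_succ
  intro i j hij
  exact (h hij).preimage fun ξ : Fin m → Rd d => 1 + ‖WithLp.toLp 2 ξ‖

lemma iUnion_frequencyShell : ⋃ j, frequencyShell m d j = Set.univ := by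
  refine Set.eq_univ_of_forall fun ξ => Set.mem_iUnion.2 ?_
  exact exists_nat_pow_near (x := 1 + ‖WithLp.toLp 2 ξ‖) (by simp) one_lt_two

/-- Sharp cutoffs suffice, since the shell estimates use only the size and support of `H`. -/
lemma enorm_diagonalFourierInv_le_tsum {H k : (Fin m → Rd d) → ℂ}
    (hHk : Integrable fun ξ => H ξ * k ξ) (x : Rd d) :
    ‖diagonalFourierInv (fun ξ => H ξ * k ξ) x‖ₑ ≤ ∑' j,
      ‖diagonalFourierInv (fun ξ => (frequencyShell m d j).indicator H ξ * k ξ) x‖ₑ := by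
  have hint : Integrable fun ξ : Fin m → Rd d =>
      (Real.fourierChar (inner ℝ (∑ i, ξ i) x) : ℂ) * (H ξ * k ξ) := by
    refine hHk.mono ?_ (Filter.Eventually.of_forall fun ξ => ?_)
    · refine AEStronglyMeasurable.mul ?_ hHk.aestronglyMeasurable
      exact (by fun_prop : Continuous fun ξ : Fin m → Rd d =>
        (Real.fourierChar (inner ℝ (∑ i, ξ i) x) : ℂ)).aestronglyMeasurable
    · rw [norm_mul, Circle.norm_coe, one_mul]
  have h := integral_iUnion measurableSet_frequencyShell pairwise_disjoint_frequencyShell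
    hint.integrableOn
  rw [iUnion_frequencyShell, setIntegral_univ] at h
  rw [diagonalFourierInv, h]
  refine enorm_tsum_le_tsum_enorm.trans (le_of_eq (tsum_congr fun j => ?_))
  rw [← integral_indicator (measurableSet_frequencyShell j), diagonalFourierInv]
  congr 2
  ext ξ
  by_cases hξ : ξ ∈ frequencyShell m d j <;> simp [hξ]

lemma volume_closedBall_pow_two (n j : ℕ) :
    volume (Metric.closedBall (0 : Rd d) (2 ^ (j + 1))) ^ n =
      ENNReal.ofReal (2 ^ (d * n) * (2 ^ j) ^ (d * n)) *
        volume (Metric.ball (0 : Rd d) 1) ^ n := by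
  rw [Measure.addHaar_closedBall _ _ (by positivity), finrank_euclideanSpace_fin, mul_pow,
    ← ENNReal.ofReal_pow (by positivity)]
  congr 2
  rw [pow_succ, ← pow_mul, mul_pow, mul_comm]

/-- With `q = 2^j ≥ 1`, each Sobolev term is at most a constant times `q · q^{-2s}`; the volume
factor `q^D` then gives the square of `q^{D/2 + 1/2 - s}`. -/
lemma shell_constant_le {s A C : ℝ} (D j : ℕ) :
    ((A * (2 ^ j) ^ (-s)) ^ 2 + 2 ^ j * (A * (2 ^ j) ^ (-s)) ^ 2 +
      (2 ^ j)⁻¹ * (C * 2 ^ (j + 1) * (2 ^ j) ^ (-s)) ^ 2) * (2 ^ D * (2 ^ j) ^ D) ≤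
    2 ^ D * (2 * A ^ 2 + 4 * C ^ 2) * (((2 : ℝ) ^ ((D : ℝ) / 2 + 1 / 2 - s)) ^ j) ^ 2 := by
  set q : ℝ := 2 ^ j with hq
  have hq1 : 1 ≤ q := one_le_pow₀ one_le_two
  have hq0 : 0 < q := by linarith
  have h1 : (((2 : ℝ) ^ ((D : ℝ) / 2 + 1 / 2 - s)) ^ j) ^ 2 = q ^ D * q * (q ^ (-s)) ^ 2 := by
    rw [← Real.rpow_natCast _ j, ← Real.rpow_mul zero_le_two, mul_comm, Real.rpow_mul zero_le_two,
      Real.rpow_natCast, ← hq, ← Real.rpow_natCast _ 2, ← Real.rpow_mul hq0.le,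
      ← Real.rpow_natCast q D, ← Real.rpow_natCast _ 2, ← Real.rpow_mul hq0.le,
      ← Real.rpow_add_one hq0.ne', ← Real.rpow_add hq0]
    congr 1
    push_cast
    ring
  have h2 : (2 : ℝ) ^ (j + 1) = 2 * q := by rw [pow_succ, mul_comm]
  rw [h1, h2]
  set w := (q ^ (-s)) ^ 2 with hw
  have h3 : ((A * q ^ (-s)) ^ 2 + q * (A * q ^ (-s)) ^ 2 +
      q⁻¹ * (C * (2 * q) * q ^ (-s)) ^ 2) = (A ^ 2 + q * A ^ 2 + 4 * C ^ 2 * q) * w := by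
    rw [hw]
    field_simp
    ring
  rw [h3]
  have h4 : A ^ 2 + q * A ^ 2 + 4 * C ^ 2 * q ≤ (2 * A ^ 2 + 4 * C ^ 2) * q := by
    nlinarith [sq_nonneg A]
  calc _ ≤ (2 * A ^ 2 + 4 * C ^ 2) * q * w * (2 ^ D * q ^ D) := by gcongr
    _ = _ := by ring

lemma continuous_measureFourier_dilate (σ : Measure (Rmd m d)) [IsFiniteMeasure σ] :
    Continuous fun p : (Fin m → Rd d) × ℝ => measureFourier σ (p.2 • WithLp.toLp 2 p.1) := by
  have h : Continuous fun p : (Fin m → Rd d) × ℝ => p.2 • WithLp.toLp 2 p.1 := by fun_prop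
  exact (continuous_measureFourier σ).comp h

lemma continuous_diagonalFourierInv_measureFourier (σ : Measure (Rmd m d)) [IsFiniteMeasure σ]
    {H : (Fin m → Rd d) → ℂ} (hH : Integrable H) (t : ℝ) :
    Continuous (diagonalFourierInv fun ξ => H ξ * measureFourier σ (t • WithLp.toLp 2 ξ)) := by
  exact continuous_diagonalFourierInv_mul_apply hH
    (k := fun ξ t => measureFourier σ (t • WithLp.toLp 2 ξ))
    (continuous_measureFourier_dilate σ) (M := σ.real Set.univ)
    (fun ξ _ t => norm_measureFourier_le σ _) t

lemma continuous_measureFourierDeriv_dilate {σ : Measure (Rmd m d)} [IsFiniteMeasure σ]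
    (hsupp : σ (Metric.closedBall (0 : Rmd m d) 1)ᶜ = 0) :
    Continuous fun p : (Fin m → Rd d) × ℝ => measureFourierDeriv σ (WithLp.toLp 2 p.1) p.2 := by
  have h := continuous_measureFourierDeriv hsupp
  fun_prop

lemma lintegral_localMaximal_shell_le {n : ℕ} {s A C : ℝ} (hs : 0 ≤ s)
    (σ : Measure (Rmd (n + 1) d)) [IsFiniteMeasure σ]
    (hsupp : σ (Metric.closedBall (0 : Rmd (n + 1) d) 1)ᶜ = 0)
    (hA : ∀ ξ : Rmd (n + 1) d, ‖measureFourier σ ξ‖ ≤ A * (1 + ‖ξ‖) ^ (-s))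
    (hC0 : 0 ≤ C) (hC : ∀ (ξ : Rmd (n + 1) d) (t : ℝ),
      ‖measureFourierDeriv σ ξ t‖ ≤ C * ‖ξ‖ * (1 + ‖t • ξ‖) ^ (-s))
    {H : (Fin (n + 1) → Rd d) → ℂ} (hH : Integrable H) (j : ℕ) :
    ∫⁻ x, (⨆ t ∈ Set.Ioo (1 : ℝ) 2,
      ‖diagonalFourierInv (fun ξ => (frequencyShell (n + 1) d j).indicator H ξ *
        measureFourier σ (t • WithLp.toLp 2 ξ)) x‖ₑ) ^ 2 ≤
      (ENNReal.ofReal (2 ^ (d * n) * (2 * A ^ 2 + 4 * C ^ 2)) *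
        volume (Metric.ball (0 : Rd d) 1) ^ n * ∫⁻ ξ, ‖H ξ‖ₑ ^ 2) *
      (ENNReal.ofReal ((2 : ℝ) ^ (((d * n : ℕ) : ℝ) / 2 + 1 / 2 - s)) ^ j) ^ 2 := by
  have hA0 : 0 ≤ A := by simpa using (norm_nonneg _).trans (hA 0)
  set H' := (frequencyShell (n + 1) d j).indicator H with hH'
  have hH'i : Integrable H' := hH.indicator (measurableSet_frequencyShell j)
  have hmem : ∀ ξ, H' ξ ≠ 0 → ξ ∈ frequencyShell (n + 1) d j :=
    fun ξ h => Set.mem_of_indicator_ne_zero h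
  have hle : ∀ ξ, H' ξ ≠ 0 → ‖WithLp.toLp 2 ξ‖ ≤ 2 ^ (j + 1) := fun ξ h => by
    have := (hmem ξ h).2
    linarith
  have hdec : ∀ ξ, H' ξ ≠ 0 → ∀ t ∈ Set.Icc (1 : ℝ) 2,
      (1 + ‖t • WithLp.toLp 2 ξ‖) ^ (-s) ≤ ((2 : ℝ) ^ j) ^ (-s) := by
    intro ξ h t ht
    refine Real.rpow_le_rpow_of_nonpos (by positivity) ((hmem ξ h).1.trans ?_) (by linarith)
    rw [norm_smul, Real.norm_of_nonneg (by linarith [ht.1])]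
    nlinarith [norm_nonneg (WithLp.toLp 2 ξ), ht.1]
  have hR : ∀ ξ, H' ξ ≠ 0 → ∀ i, ‖ξ i‖ ≤ 2 ^ (j + 1) :=
    fun ξ h i => (PiLp.norm_apply_le (WithLp.toLp 2 ξ) i).trans (hle ξ h)
  have hk' : Continuous fun p : (Fin (n + 1) → Rd d) × ℝ =>
      measureFourierDeriv σ (WithLp.toLp 2 p.1) p.2 := by
    exact continuous_measureFourierDeriv_dilate hsupp
  have hM' : ∀ ξ, H' ξ ≠ 0 → ∀ t, ‖measureFourierDeriv σ (WithLp.toLp 2 ξ) t‖ ≤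
      2 * Real.pi * 2 ^ (j + 1) * σ.real Set.univ := by
    intro ξ h t
    refine (norm_measureFourierDeriv_le hsupp _ t).trans ?_
    gcongr
    exact hle ξ h
  have ha : ∀ ξ, H' ξ ≠ 0 → ∀ t ∈ Set.Icc (1 : ℝ) 2,
      ‖measureFourier σ (t • WithLp.toLp 2 ξ)‖ ≤ A * (2 ^ j) ^ (-s) :=
    fun ξ h t ht => (hA _).trans (mul_le_mul_of_nonneg_left (hdec ξ h t ht) hA0)
  have hb : ∀ ξ, H' ξ ≠ 0 → ∀ t ∈ Set.Icc (1 : ℝ) 2,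
      ‖measureFourierDeriv σ (WithLp.toLp 2 ξ) t‖ ≤ C * 2 ^ (j + 1) * (2 ^ j) ^ (-s) := by
    intro ξ h t ht
    refine (hC _ t).trans (mul_le_mul ?_ (hdec ξ h t ht) (by positivity) (by positivity))
    exact mul_le_mul_of_nonneg_left (hle ξ h) hC0
  -- The choice `c = 2^j` balances the two Sobolev terms, as the derivative is larger by about
  -- `2^j`. The bound `M` serves only dominated convergence and does not enter the estimate.
  have hmain := lintegral_iSup_diagonalFourierInv_mul_le n (c := 2 ^ j)
    (k := fun ξ t => measureFourier σ (t • WithLp.toLp 2 ξ))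
    (k' := fun ξ t => measureFourierDeriv σ (WithLp.toLp 2 ξ) t)
    (M := max (σ.real Set.univ) (2 * Real.pi * 2 ^ (j + 1) * σ.real Set.univ))
    hH'i hR (continuous_measureFourier_dilate σ) hk'
    (fun ξ t => hasDerivAt_measureFourier_smul hsupp _ t)
    (fun ξ _ t => (norm_measureFourier_le σ _).trans (le_max_left _ _))
    (fun ξ h t => (hM' ξ h t).trans (le_max_right _ _)) (by positivity) ha hb
  refine hmain.trans ?_
  have hHH' : ∫⁻ ξ, ‖H' ξ‖ₑ ^ 2 ≤ ∫⁻ ξ, ‖H ξ‖ₑ ^ 2 := by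
    refine lintegral_mono fun ξ => ?_
    gcongr
    exact enorm_indicator_le_enorm_self H ξ
  rw [volume_closedBall_pow_two]
  have hconst := ENNReal.ofReal_le_ofReal (shell_constant_le (s := s) (A := A) (C := C) (d * n) j)
  rw [ENNReal.ofReal_mul (by positivity), ENNReal.ofReal_mul (q := (_ ^ j) ^ 2) (by positivity),
    ENNReal.ofReal_pow (by positivity), ENNReal.ofReal_pow (by positivity)] at hconst
  calc _ = (ENNReal.ofReal ((A * (2 ^ j) ^ (-s)) ^ 2 + 2 ^ j * (A * (2 ^ j) ^ (-s)) ^ 2 +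
          (2 ^ j)⁻¹ * (C * 2 ^ (j + 1) * (2 ^ j) ^ (-s)) ^ 2) *
          ENNReal.ofReal (2 ^ (d * n) * (2 ^ j) ^ (d * n))) *
        (volume (Metric.ball (0 : Rd d) 1) ^ n * ∫⁻ ξ, ‖H' ξ‖ₑ ^ 2) := by ring
    _ ≤ _ := mul_le_mul' hconst (mul_le_mul_right hHH' _)
    _ = _ := by ring

lemma measurable_localMaximal (σ : Measure (Rmd m d)) [IsFiniteMeasure σ]
    (f : Fin m → 𝓢(Rd d, ℂ)) : Measurable (localMaximal σ f) := by
  refine measurable_iSup_enorm fun t => ?_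
  simp_rw [multiAverage_eq_diagonalFourierInv]
  exact continuous_diagonalFourierInv_measureFourier σ (integrable_tensorFourier f) t

/-- The `L² × ⋯ × L² → L²` bound for the multilinear local maximal function. -/
theorem exists_lintegral_localMaximal_sq_le {s A : ℝ} (hm : 1 ≤ m)
    (hs : ((m : ℝ) - 1) * (d : ℝ) / 2 + 1 / 2 < s)
    (σ : Measure (Rmd m d)) [IsFiniteMeasure σ]
    (hsupp : σ (Metric.closedBall (0 : Rmd m d) 1)ᶜ = 0)
    (hA : ∀ ξ : Rmd m d, ‖measureFourier σ ξ‖ ≤ A * (1 + ‖ξ‖) ^ (-s)) :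
    ∃ B : ℝ≥0, ∀ f : Fin m → 𝓢(Rd d, ℂ),
      ∫⁻ x, localMaximal σ f x ^ 2 ≤ B * ∏ i, ∫⁻ x, ‖f i x‖ₑ ^ 2 := by
  obtain ⟨n, rfl⟩ : ∃ n, m = n + 1 := ⟨m - 1, by omega⟩
  have hs' : ((d * n : ℕ) : ℝ) / 2 + 1 / 2 - s < 0 := by
    push_cast at hs ⊢
    nlinarith
  have hs0 : 0 ≤ s := by
    have : (0 : ℝ) ≤ ((d * n : ℕ) : ℝ) := Nat.cast_nonneg _
    linarith
  obtain ⟨C, hC0, hC⟩ := exists_norm_measureFourierDeriv_le hs0 σ hsupp hA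
  set r := ENNReal.ofReal ((2 : ℝ) ^ (((d * n : ℕ) : ℝ) / 2 + 1 / 2 - s)) with hr
  have hr0 : r ≠ 0 := (ENNReal.ofReal_pos.2 (by positivity)).ne'
  have hr1 : r < 1 := by
    rw [hr, ENNReal.ofReal_lt_one]
    exact Real.rpow_lt_one_of_one_lt_of_neg one_lt_two hs'
  set K := ENNReal.ofReal (2 ^ (d * n) * (2 * A ^ 2 + 4 * C ^ 2)) *
    volume (Metric.ball (0 : Rd d) 1) ^ n with hK
  have hKtop : K ≠ ⊤ :=
    ENNReal.mul_ne_top ENNReal.ofReal_ne_top (ENNReal.pow_ne_top measure_ball_lt_top.ne)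
  have hBtop : (1 - r)⁻¹ ^ 2 * K ≠ ⊤ := ENNReal.mul_ne_top
    (ENNReal.pow_ne_top (ENNReal.inv_ne_top.2 (tsub_pos_of_lt hr1).ne')) hKtop
  refine ⟨((1 - r)⁻¹ ^ 2 * K).toNNReal, fun f => ?_⟩
  rw [ENNReal.coe_toNNReal hBtop, ← lintegral_enorm_sq_tensorFourier]
  have hF := integrable_tensorFourier f
  let g : ℕ → Rd d → ℝ → ℂ := fun j x t => diagonalFourierInv (fun ξ =>
    (frequencyShell (n + 1) d j).indicator (tensorFourier f) ξ *
      measureFourier σ (t • WithLp.toLp 2 ξ)) x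
  have hg : ∀ j t, Continuous fun x => g j x t := fun j t =>
    continuous_diagonalFourierInv_measureFourier σ
      (hF.indicator (measurableSet_frequencyShell j)) t
  have hpt : ∀ x, localMaximal σ f x ≤ ∑' j, ⨆ t ∈ Set.Ioo (1 : ℝ) 2, ‖g j x t‖ₑ := by
    intro x
    refine iSup₂_le fun t ht => ?_
    rw [multiAverage_eq_diagonalFourierInv]
    have hk : Continuous fun ξ : Fin (n + 1) → Rd d => measureFourier σ (t • WithLp.toLp 2 ξ) :=
      (continuous_measureFourier σ).comp (by fun_prop)
    have hint : Integrable fun ξ : Fin (n + 1) → Rd d =>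
        tensorFourier f ξ * measureFourier σ (t • WithLp.toLp 2 ξ) := by
      refine (hF.norm.mul_const (σ.real Set.univ)).mono' (hF.aestronglyMeasurable.mul
        hk.aestronglyMeasurable)
        (Filter.Eventually.of_forall fun ξ => ?_)
      rw [norm_mul]
      gcongr
      exact norm_measureFourier_le σ _
    refine (enorm_diagonalFourierInv_le_tsum hint x).trans (ENNReal.tsum_le_tsum fun j => ?_)
    exact le_iSup₂ (f := fun t (_ : t ∈ Set.Ioo (1 : ℝ) 2) => ‖g j x t‖ₑ) t ht
  calc _ ≤ ∫⁻ x, (∑' j, ⨆ t ∈ Set.Ioo (1 : ℝ) 2, ‖g j x t‖ₑ) ^ 2 := by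
        gcongr with x
        exact hpt x
    _ ≤ (1 - r)⁻¹ ^ 2 * (K * ∫⁻ ξ, ‖tensorFourier f ξ‖ₑ ^ 2) :=
        lintegral_tsum_sq_le (fun j => measurable_iSup_enorm (hg j)) hr0 hr1 fun j =>
          lintegral_localMaximal_shell_le hs0 σ hsupp hA hC0 hC hF j
    _ = _ := (mul_assoc _ _ _).symm

end GlobalL2

/-! ### Lower exponents: Hölder on balls and averaging over centres. -/

section Localization

variable {m d : ℕ}

lemma eLpNorm_schwartz_two (f : 𝓢(Rd d, ℂ)) :
    eLpNorm f 2 volume = (∫⁻ x, ‖f x‖ₑ ^ 2) ^ (1 / 2 : ℝ) := by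
  simp [eLpNorm_eq_lintegral_rpow_enorm_toReal]

lemma eLpNorm_ennreal_eq {α : Type*} [MeasurableSpace α] {μ : Measure α} {p : ℝ≥0∞}
    (hp0 : p ≠ 0) (hp : p ≠ ⊤) (g : α → ℝ≥0∞) :
    eLpNorm g p μ = (∫⁻ x, g x ^ p.toReal ∂μ) ^ (1 / p.toReal) := by
  simp [eLpNorm_eq_lintegral_rpow_enorm_toReal hp0 hp]

/-- Hölder on a ball of volume `v` costs `v^{1/p - 1/2}`. This exponent lies in `[0, m/2]`, so `max
1 v` to the power `m/2` bounds it uniformly in `p` and in the centre. -/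
lemma eLpNorm_localMaximal_closedBall_le {σ : Measure (Rmd m d)} [IsFiniteMeasure σ] (hm : 1 ≤ m)
    {B : ℝ≥0} (hB : ∀ f : Fin m → 𝓢(Rd d, ℂ),
      ∫⁻ x, localMaximal σ f x ^ 2 ≤ B * ∏ i, ∫⁻ x, ‖f i x‖ₑ ^ 2)
    {p : ℝ≥0∞} (hp : 2 / (m : ℝ≥0∞) ≤ p) (hp2 : p ≤ 2) (f : Fin m → 𝓢(Rd d, ℂ)) (a : Rd d) :
    eLpNorm (localMaximal σ f) p (volume.restrict (Metric.closedBall a 1)) ≤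
      (B : ℝ≥0∞) ^ (1 / 2 : ℝ) *
        (max 1 (volume (Metric.closedBall (0 : Rd d) 1))) ^ ((m : ℝ) / 2) *
        ∏ i, eLpNorm (f i) 2 volume := by
  have hm0 : (0 : ℝ) < m := by exact_mod_cast hm
  have hptop : p ≠ ⊤ := (hp2.trans_lt ENNReal.ofNat_lt_top).ne
  have hpr : 2 / (m : ℝ) ≤ p.toReal := by
    have := ENNReal.toReal_mono hptop hp
    simpa using this
  have hexp : 1 / p.toReal - 1 / (2 : ℝ≥0∞).toReal ≤ (m : ℝ) / 2 := by
    have h1 : 1 / p.toReal ≤ 1 / (2 / (m : ℝ)) := one_div_le_one_div_of_le (by positivity) hpr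
    rw [one_div_div] at h1
    have h2 : (0 : ℝ) ≤ 1 / (2 : ℝ≥0∞).toReal := by positivity
    linarith
  have hexp0 : 0 ≤ 1 / p.toReal - 1 / (2 : ℝ≥0∞).toReal := by
    have h1 : 1 / (2 : ℝ≥0∞).toReal ≤ 1 / p.toReal :=
      one_div_le_one_div_of_le ((by positivity : 0 < 2 / (m : ℝ)).trans_le hpr)
        (ENNReal.toReal_mono (by norm_num) hp2)
    linarith
  have h2 : eLpNorm (localMaximal σ f) 2 (volume.restrict (Metric.closedBall a 1)) ≤
      (B : ℝ≥0∞) ^ (1 / 2 : ℝ) * ∏ i, eLpNorm (f i) 2 volume := by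
    refine (eLpNorm_mono_measure _ Measure.restrict_le_self).trans ?_
    rw [eLpNorm_ennreal_eq (by norm_num) (by norm_num)]
    simp only [ENNReal.toReal_ofNat, ENNReal.rpow_two, eLpNorm_schwartz_two]
    rw [ENNReal.prod_rpow_of_nonneg (by norm_num), ← ENNReal.mul_rpow_of_nonneg _ _ (by norm_num)]
    gcongr
    exact hB f
  refine (eLpNorm_le_eLpNorm_mul_rpow_measure_univ hp2
    (measurable_localMaximal σ f).aestronglyMeasurable).trans ?_
  rw [Measure.restrict_apply_univ, Measure.addHaar_closedBall_center]
  calc _ ≤ ((B : ℝ≥0∞) ^ (1 / 2 : ℝ) * ∏ i, eLpNorm (f i) 2 volume) *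
        (max 1 (volume (Metric.closedBall (0 : Rd d) 1))) ^ ((m : ℝ) / 2) := by
        refine mul_le_mul' h2 ?_
        exact (ENNReal.rpow_le_rpow (le_max_right _ _) hexp0).trans
          (ENNReal.rpow_le_rpow_of_exponent_le (le_max_left _ _) hexp)
    _ = _ := by ring

/-- Only the values of the functions near a ball contribute to the maximal function on it. -/
lemma exists_schwartz_localization {σ : Measure (Rmd m d)}
    (hsupp : σ (Metric.closedBall (0 : Rmd m d) 1)ᶜ = 0) (f : Fin m → 𝓢(Rd d, ℂ)) (a : Rd d) :
    ∃ g : Fin m → 𝓢(Rd d, ℂ),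
      (∀ i z, ‖g i z‖ₑ ≤ (Metric.closedBall a 4).indicator (fun z => ‖f i z‖ₑ) z) ∧
      ∀ x ∈ Metric.closedBall a 1, localMaximal σ f x = localMaximal σ g x := by
  -- The radius `3` is `1 + 2 · 1`: `x` is within `1` of `a`, `t < 2`, and `‖y i‖ ≤ 1` on the
  -- support.
  let χ : ContDiffBump a := ⟨3, 4, by norm_num, by norm_num⟩
  have hχs : ContDiff ℝ ∞ fun x => (χ x : ℂ) := Complex.ofRealCLM.contDiff.comp χ.contDiff
  have hχc : HasCompactSupport fun x => (χ x : ℂ) :=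
    HasCompactSupport.comp_left (g := Complex.ofReal) χ.hasCompactSupport Complex.ofReal_zero
  have hs : ∀ i, ContDiff ℝ ∞ fun x => f i x * (χ x : ℂ) := fun i => (f i).smooth'.mul hχs
  let g : Fin m → 𝓢(Rd d, ℂ) := fun i => hχc.mul_left.toSchwartzMap (hs i)
  have hg : ∀ i z, g i z = f i z * (χ z : ℂ) := fun i z => rfl
  refine ⟨g, fun i z => ?_, fun x hx => ?_⟩
  · by_cases hz : z ∈ Metric.closedBall a 4
    · rw [Set.indicator_of_mem hz, hg, ← ofReal_norm, ← ofReal_norm, norm_mul, Complex.norm_real,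
        Real.norm_of_nonneg χ.nonneg]
      exact ENNReal.ofReal_le_ofReal (mul_le_of_le_one_right (norm_nonneg _) χ.le_one)
    · have hz' : χ.rOut ≤ dist z a := by
        change (4 : ℝ) ≤ dist z a
        exact (not_le.1 fun h => hz (Metric.mem_closedBall.2 h)).le
      rw [hg, χ.zero_of_le_dist hz']
      simp
  · have hae : ∀ᵐ y ∂σ, y ∈ Metric.closedBall (0 : Rmd m d) 1 := by rw [ae_iff]; exact hsupp
    refine iSup_congr fun t => iSup_congr fun ht => ?_
    congr 1
    refine integral_congr_ae (hae.mono fun y hy => ?_)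
    refine Finset.prod_congr rfl fun i _ => ?_
    rw [hg, χ.one_of_mem_closedBall, Complex.ofReal_one, mul_one]
    change x - t • y i ∈ Metric.closedBall a 3
    have hyi : ‖y i‖ ≤ 1 := (PiLp.norm_apply_le y i).trans (by simpa using hy)
    have hty : ‖t • y i‖ ≤ 2 := by
      rw [norm_smul, Real.norm_of_nonneg (by linarith [ht.1])]
      nlinarith [ht.1, ht.2, norm_nonneg (y i)]
    rw [mem_closedBall_iff_norm] at hx ⊢
    calc ‖x - t • y i - a‖ = ‖(x - a) - t • y i‖ := by congr 1; abel
      _ ≤ ‖x - a‖ + ‖t • y i‖ := norm_sub_le _ _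
      _ ≤ 3 := by linarith

lemma measurable_indicator_closedBall_prod {g : Rd d → ℝ≥0∞} (hg : Measurable g) (r : ℝ) :
    Measurable fun p : Rd d × Rd d => (Metric.closedBall p.1 r).indicator g p.2 := by
  have hs : MeasurableSet {p : Rd d × Rd d | dist p.2 p.1 ≤ r} :=
    (isClosed_le (by fun_prop) continuous_const).measurableSet
  exact (hg.comp measurable_snd).indicator hs

lemma measurable_setLIntegral_closedBall {g : Rd d → ℝ≥0∞} (hg : Measurable g) (r : ℝ) :
    Measurable fun a => ∫⁻ x in Metric.closedBall a r, g x := by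
  simp_rw [← lintegral_indicator Metric.isClosed_closedBall.measurableSet]
  exact (measurable_indicator_closedBall_prod hg r).lintegral_prod_right'

/-- Tonelli: `x` lies in the ball about `a` exactly when `a` lies in the ball about `x`. -/
lemma lintegral_setLIntegral_closedBall {g : Rd d → ℝ≥0∞} (hg : Measurable g) (r : ℝ) :
    ∫⁻ a, ∫⁻ x in Metric.closedBall a r, g x =
      volume (Metric.closedBall (0 : Rd d) r) * ∫⁻ x, g x := by
  simp_rw [← lintegral_indicator Metric.isClosed_closedBall.measurableSet]
  rw [lintegral_lintegral_swap (measurable_indicator_closedBall_prod hg r).aemeasurable,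
    ← lintegral_const_mul _ hg]
  refine lintegral_congr fun x => ?_
  have : ∀ a, (Metric.closedBall a r).indicator g x =
      (Metric.closedBall x r).indicator (fun _ => g x) a := by
    intro a
    simp only [Set.indicator, Metric.mem_closedBall, dist_comm]
  simp_rw [this]
  rw [lintegral_indicator_const Metric.isClosed_closedBall.measurableSet,
    Measure.addHaar_closedBall_center, mul_comm]

/-- Passing from local estimates, uniform over balls, to a global estimate. -/
lemma eLpNorm_localMaximal_le_of_closedBall {σ : Measure (Rmd m d)} [IsFiniteMeasure σ]
    (hm : 1 ≤ m) (hsupp : σ (Metric.closedBall (0 : Rmd m d) 1)ᶜ = 0) {C : ℝ≥0∞}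
    (hC : ∀ (f : Fin m → 𝓢(Rd d, ℂ)) (a : Rd d),
      eLpNorm (localMaximal σ f) (2 / (m : ℝ≥0∞)) (volume.restrict (Metric.closedBall a 1)) ≤
        C * ∏ i, eLpNorm (f i) 2 volume) (f : Fin m → 𝓢(Rd d, ℂ)) :
    eLpNorm (localMaximal σ f) (2 / (m : ℝ≥0∞)) volume ≤
      ((volume (Metric.closedBall (0 : Rd d) 1))⁻¹ *
        volume (Metric.closedBall (0 : Rd d) 4)) ^ ((m : ℝ) / 2) * C *
        ∏ i, eLpNorm (f i) 2 volume := by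
  have hm0 : (0 : ℝ) < m := by exact_mod_cast hm
  have hp0 : 2 / (m : ℝ≥0∞) ≠ 0 := ENNReal.div_ne_zero.2 ⟨by norm_num, ENNReal.natCast_ne_top m⟩
  have hptop : 2 / (m : ℝ≥0∞) ≠ ⊤ :=
    ENNReal.div_ne_top (by norm_num) (by exact_mod_cast (by omega : m ≠ 0))
  have hpr : (2 / (m : ℝ≥0∞)).toReal = 2 / m := by simp
  set q : ℝ := 2 / m with hq
  have hq0 : 0 < q := by positivity
  have hqinv : 1 / q = m / 2 := by rw [hq, one_div_div]
  set v := volume (Metric.closedBall (0 : Rd d) 1) with hv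
  set w := volume (Metric.closedBall (0 : Rd d) 4) with hw
  have hv0 : v ≠ 0 := (Metric.measure_closedBall_pos _ _ one_pos).ne'
  have hvtop : v ≠ ⊤ := measure_closedBall_lt_top.ne
  have hfm : ∀ i, Measurable fun x => ‖f i x‖ₑ ^ 2 :=
    fun i => (f i).continuous.enorm.measurable.pow_const 2
  set M := localMaximal σ f with hM
  have hMm : Measurable M := measurable_localMaximal σ f
  have hloc : ∀ a, ∫⁻ x in Metric.closedBall a 1, M x ^ q ≤
      C ^ q * ∏ i, (∫⁻ x in Metric.closedBall a 4, ‖f i x‖ₑ ^ 2) ^ (1 / m : ℝ) := by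
    intro a
    obtain ⟨g, hgf, hg⟩ := exists_schwartz_localization hsupp f a
    have h1 := hC g a
    rw [eLpNorm_ennreal_eq hp0 hptop, hpr, one_div, ENNReal.rpow_inv_le_iff hq0,
      ENNReal.mul_rpow_of_nonneg _ _ hq0.le, ← ENNReal.prod_rpow_of_nonneg hq0.le] at h1
    calc ∫⁻ x in Metric.closedBall a 1, M x ^ q
        = ∫⁻ x in Metric.closedBall a 1, localMaximal σ g x ^ q :=
          setLIntegral_congr_fun Metric.isClosed_closedBall.measurableSet
            fun x hx => by rw [hM, hg x hx]
      _ ≤ _ := h1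
      _ ≤ _ := by
          gcongr with i
          rw [eLpNorm_schwartz_two, ← ENNReal.rpow_mul,
            show (1 / 2 : ℝ) * q = 1 / m by rw [hq]; field_simp]
          refine ENNReal.rpow_le_rpow ?_ (by positivity)
          rw [← lintegral_indicator Metric.isClosed_closedBall.measurableSet]
          refine lintegral_mono fun z => ?_
          refine (pow_le_pow_left' (hgf i z) 2).trans (le_of_eq ?_)
          by_cases hz : z ∈ Metric.closedBall a 4 <;> simp [hz]
  have hsum : ∑ _i : Fin m, (1 / m : ℝ) = 1 := by
    simp only [Finset.sum_const, Finset.card_univ, Fintype.card_fin, nsmul_eq_mul]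
    field_simp
  -- Integrate the local bound over all centres `a`. The choice `q = 2/m` makes the `m` exponents
  -- `1/m` sum to `1`, as Hölder requires.
  have hglob : v * ∫⁻ x, M x ^ q ≤ C ^ q * (w * ∏ i, (∫⁻ x, ‖f i x‖ₑ ^ 2) ^ (1 / m : ℝ)) := by
    rw [hv, ← lintegral_setLIntegral_closedBall (hMm.pow_const q)]
    refine (lintegral_mono hloc).trans ?_
    rw [lintegral_const_mul]
    · gcongr
      refine (ENNReal.lintegral_prod_norm_pow_le Finset.univ
        (fun i _ => (measurable_setLIntegral_closedBall (hfm i) 4).aemeasurable) hsum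
        fun i _ => by positivity).trans (le_of_eq ?_)
      simp_rw [lintegral_setLIntegral_closedBall (hfm _),
        ENNReal.mul_rpow_of_nonneg _ _ (by positivity : (0 : ℝ) ≤ 1 / m)]
      rw [Finset.prod_mul_distrib, Finset.prod_const, ← ENNReal.rpow_natCast, ← ENNReal.rpow_mul]
      simp only [Finset.card_univ, Fintype.card_fin]
      rw [one_div_mul_cancel hm0.ne', ENNReal.rpow_one]
    · exact Finset.measurable_prod _ fun i _ =>
        (measurable_setLIntegral_closedBall (hfm i) 4).pow_const _
  have hprod : ∏ i, (∫⁻ x, ‖f i x‖ₑ ^ 2) ^ (1 / m : ℝ) = (∏ i, eLpNorm (f i) 2 volume) ^ q := by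
    rw [← ENNReal.prod_rpow_of_nonneg hq0.le]
    refine Finset.prod_congr rfl fun i _ => ?_
    rw [eLpNorm_schwartz_two, ← ENNReal.rpow_mul]
    congr 1
    rw [hq]
    field_simp
  rw [eLpNorm_ennreal_eq hp0 hptop, hpr]
  rw [one_div, ENNReal.rpow_inv_le_iff hq0, ENNReal.mul_rpow_of_nonneg _ _ hq0.le,
    ENNReal.mul_rpow_of_nonneg _ _ hq0.le, ← ENNReal.rpow_mul, ← hqinv,
    one_div_mul_cancel hq0.ne', ENNReal.rpow_one, ← hprod]
  calc ∫⁻ x, M x ^ q = v⁻¹ * (v * ∫⁻ x, M x ^ q) := by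
        rw [← mul_assoc, ENNReal.inv_mul_cancel hv0 hvtop, one_mul]
    _ ≤ v⁻¹ * (C ^ q * (w * ∏ i, (∫⁻ x, ‖f i x‖ₑ ^ 2) ^ (1 / m : ℝ))) := by gcongr
    _ = _ := by ring

end Localization

/-! ### Assembly of the local and global estimates. -/

theorem theorem1p2 (m d : ℕ) (hm : 2 ≤ m) (hd : 1 ≤ d) (s : ℝ)
    (hs : ((m : ℝ) - 1) * (d : ℝ) / 2 + 1 / 2 < s)
    (σ : Measure (Rmd m d)) [IsFiniteMeasure σ]
    (hsupp : σ (Metric.closedBall (0 : Rmd m d) 1)ᶜ = 0)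
    (hdecay : ∃ A : ℝ, ∀ ξ : Rmd m d, ‖measureFourier σ ξ‖ ≤ A * (1 + ‖ξ‖) ^ (-s)) :
    ∃ C : ℝ≥0,
      (∀ p : ℝ≥0∞, 2 / (m : ℝ≥0∞) ≤ p → p ≤ 2 → ∀ f : Fin m → 𝓢(Rd d, ℂ),
        eLpNorm (localMaximal σ f) p (volume.restrict (Metric.ball (0 : Rd d) 1)) ≤
          (C : ℝ≥0∞) * ∏ i, eLpNorm (f i) 2 volume) ∧
      (∀ f : Fin m → 𝓢(Rd d, ℂ),
        eLpNorm (localMaximal σ f) (2 / (m : ℝ≥0∞)) volume ≤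
          (C : ℝ≥0∞) * ∏ i, eLpNorm (f i) 2 volume) := by
  obtain ⟨A, hA⟩ := hdecay
  have hm1 : 1 ≤ m := by omega
  obtain ⟨B, hB⟩ := exists_lintegral_localMaximal_sq_le hm1 hs σ hsupp hA
  set C₁ : ℝ≥0∞ := (B : ℝ≥0∞) ^ (1 / 2 : ℝ) *
    (max 1 (volume (Metric.closedBall (0 : Rd d) 1))) ^ ((m : ℝ) / 2) with hC₁
  set C₂ : ℝ≥0∞ := ((volume (Metric.closedBall (0 : Rd d) 1))⁻¹ *
    volume (Metric.closedBall (0 : Rd d) 4)) ^ ((m : ℝ) / 2) * C₁ with hC₂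
  have h₁ : C₁ ≠ ⊤ := ENNReal.mul_ne_top
    (ENNReal.rpow_ne_top_of_nonneg (by norm_num) ENNReal.coe_ne_top)
    (ENNReal.rpow_ne_top_of_nonneg (by positivity)
      (max_lt ENNReal.one_lt_top measure_closedBall_lt_top).ne)
  have h₂ : C₂ ≠ ⊤ := by
    refine ENNReal.mul_ne_top (ENNReal.rpow_ne_top_of_nonneg (by positivity)
      (ENNReal.mul_ne_top (ENNReal.inv_ne_top.2 ?_) measure_closedBall_lt_top.ne)) h₁
    exact (Metric.measure_closedBall_pos _ _ one_pos).ne'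
  have h2m : 2 / (m : ℝ≥0∞) ≤ 2 :=
    ENNReal.div_le_of_le_mul (le_mul_of_one_le_right' (by exact_mod_cast hm1))
  refine ⟨(C₁ + C₂).toNNReal, fun p hp hp2 f => ?_, fun f => ?_⟩
  · rw [ENNReal.coe_toNNReal (ENNReal.add_ne_top.2 ⟨h₁, h₂⟩)]
    refine (eLpNorm_mono_measure _
      (Measure.restrict_mono_set _ Metric.ball_subset_closedBall)).trans ?_
    refine (eLpNorm_localMaximal_closedBall_le hm1 hB hp hp2 f 0).trans ?_
    gcongr
    exact le_self_add
  · rw [ENNReal.coe_toNNReal (ENNReal.add_ne_top.2 ⟨h₁, h₂⟩)]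
    refine (eLpNorm_localMaximal_le_of_closedBall hm1 hsupp (fun f a =>
      eLpNorm_localMaximal_closedBall_le hm1 hB le_rfl h2m f a) f).trans ?_
    gcongr
    exact le_add_self
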